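/- **Setting.** For each number of runs $n$ let $p_0<p$ and $M\ge p_0$ be integers (all may depend on $n$), $f_n\in C([0,1]^p)$, and let $x_1,\dots,x_n\in[0,1)^p$ be design sites with outputs $y_i=f_n(x_i)$; $X=(x_{ij})$ is the $n\times p$ design matrix, $Z_p=\{1,\dots,p\}$ and $\mathcal A_0=\{1,\dots,p_0\}$. For $\mathcal A\subset Z_p$ let $\beta_0(\mathcal A)+\beta_{Z_p}(\mathcal A)'x$, with $\beta_{Z_p}(\mathcal A)_j=0$ for $j\notin\mathcal A$, be the best $L^2([0,1]^p)$ approximation of $f_n$ by affine functions of the variables in $\mathcal A$, and let $(\widehat\beta_0(\mathcal A),\widehat\beta_{Z_p}(\mathcal A))$ be the least-squares coefficients $(W'W)^{-1}W'y$, $W=(\mathbf 1_n,X_{\mathcal A})$, padded by $0$ off $\mathcal A$. The Vitali variation of a function on a cube is the supremum, over all partitions of the cube into finitely many non-overlapping rectangles $J$, of $\sum_J|\Delta_J(g)|$, where $\Delta_J(g)$ is the alternating sum of $g$ over the vertices of $J$; the Hardy–Krause variation $V_{HK}(g)$ is the sum of the Vitali variations of the restrictions of $g$ to all faces of positive dimension.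 A function of some of the variables is regarded as a function on the cube of those variables. The discrepancy of $n$ points in $[0,1]^d$ is $\sup_{x\in[0,1]^d}|F_n(x)-\prod_j x_j|$, with $F_n$ the empirical distribution function, and $\delta(\mathcal A)$ denotes the discrepancy of the design projected to the coordinates in $\mathcal A$. Let $$\mathcal U_0=\{\mathcal A:|\mathcal A|=M,\ \mathcal A_0\subset\mathcal A\},\qquad \mathcal U_1=\{\mathcal A:|\mathcal A|=M,\ \mathcal A_0\setminus\mathcal A\ne\emptyset\},$$ $\Delta_{p_0}=\delta(\mathcal A_0)$, $\Delta_2=\max_{|\mathcal A|=2}\delta(\mathcal A)$, $\Delta_{p_0+1}=\max_{|I|=1}\delta(\mathcal A_0\cup I)$ and $\Delta_{p_0+M-1}=\max_{|I|=M-1}\delta(\mathcal A_0\cup I)$, where $I\subset Z_p\setminus\mathcal A_0$ (a maximum over an empty family is $0$). **Assumption 1 (near sparsity).** There is a constant $\tau>0$, independent of $n$, and for each $n$ there are $\widetilde f_n\in C([0,1]^{p_0})$ and $\eta_n>0$ such that $\sup_{x\in[0,1]^p}|f_n(x)-\widetilde f_n(x_{\mathcal A_0})|<\eta_n$ and $\bigl|\int_{[0,1]^p}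 x_jf_n\,dx-\frac12\int_{[0,1]^p} f_n\,dx\bigr|>\tau$ for $j=1,\dots,p_0$. **Assumption 2.** $V_{HK}(\widetilde f_n)<\infty$ for each $n$. **Assumption 3.** There is a constant $\alpha\in(0,1)$ with $3(M+1)^2(9M+1)\Delta_2<\alpha$ for all sufficiently large $n$. Put $R_{\mathcal A}(x)=\widetilde f_n(x_{\mathcal A_0})-\beta_0(\mathcal A)-\beta_{Z_p}(\mathcal A)'x$ and, with maxima of functions taken over $[0,1]^p$, $$C_1=\max_{1\le j\le p}\max\bigl(V_{HK}(\widetilde f_n),V_{HK}(x_j\widetilde f_n)\bigr),\quad C_2=\max|f_n|,\quad C_3=\max|R_{\mathcal A_0}|,\quad C_4=\max_{\mathcal A\in\mathcal U_1}\max|R_{\mathcal A}|,$$ $V_1=V_{HK}(R_{\mathcal A_0})$, $V_2=\max_{\mathcal A\in\mathcal U_1}V_{HK}(R_{\mathcal A})$ (with $R_{\mathcal A}$ a function of the variables in $\mathcal A_0\cup\mathcal A$), $$\zeta_1=C_1(p_0+1)^2(9p_0+1)\Delta_{p_0}+2(p_0+1)^2(9p_0+1)\eta_n+\tfrac{3}{1-\alpha}C_2(p_0+1)^4(9p_0+1)^2\Delta_2,$$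 $$\zeta_2=C_1(M+1)^2(9M+1)\Delta_{p_0+1}+2(M+1)^2(9M+1)\eta_n+\tfrac{3}{1-\alpha}C_2(M+1)^4(9M+1)^2\Delta_2,$$ $$\rho_1=\zeta_1^2+2(C_3+\eta_n)\zeta_1+2(p_0+1)^{-1/2}\zeta_1^2,\qquad \rho_2=\zeta_2^2+2(C_4+\eta_n)\zeta_2+2(M+1)^{-1/2}\zeta_2^2.$$ **Assumption 4.** There is a constant $D>0$ such that for all sufficiently large $n$ $$12\tau^2-12(M-p_0+1)\eta_n^2-4\eta_n^2-4\eta_n(C_4+C_3)-\Delta_{p_0}V_1-\Delta_{p_0+M-1}V_2-\rho_1-\rho_2>D.$$ **Theorem.** Under Assumptions 1–4, for all sufficiently large $n$, every $\mathcal A\in\mathcal U_0$ and every $\mathcal A_1\in\mathcal U_1$ satisfy $$\bigl\|y-\mathbf 1_n\widehat\beta_0(\mathcal A)-X\widehat\beta_{Z_p}(\mathcal A)\bigr\|^2<\bigl\|y-\mathbf 1_n\widehat\beta_0(\mathcal A_1)-X\widehat\beta_{Z_p}(\mathcal A_1)\bigr\|^2,$$ that is, the maximum of the residual sum of squares over $\mathcal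 U_0$ is strictly smaller than its minimum over $\mathcal U_1$. -/

import Mathlib

open Set Filter
open scoped ENNReal

namespace LinearScreening

noncomputable section

/-! ### Hardy–Krause variation and `L_∞` discrepancy

Both take values in `[0, ∞]`. Vectors are functions `ι → ℝ` on a finite index type and the unit
cube `[0,1]^ι` is `Icc 0 1`. -/

/-- The unit cube as a box. (Mathlib's boxes are products of intervals `(a i, b i]`; a partition
into such boxes amounts to a partition of the closed cube into closed rectangles with pairwise
disjoint interiors.) -/
def unitBox (ι : Type*) : BoxIntegral.Box ι := ⟨0, 1, fun _ => zero_lt_one⟩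

/-- The alternating sum of the values of `g` at the `2^d` vertices of the rectangle `J`. -/
def boxDiff {ι : Type*} [Fintype ι] [DecidableEq ι] (g : (ι → ℝ) → ℝ)
    (J : BoxIntegral.Box ι) : ℝ :=
  ∑ T : Finset ι, (-1 : ℝ) ^ T.card * g (fun i => if i ∈ T then J.lower i else J.upper i)

/-- The Vitali variation of `g` on the unit cube: the supremum of `∑_{J ∈ Π} |Δ_J(g)|` over all
partitions `Π` of the cube into finitely many non-overlapping rectangles. -/
def vitaliVariation {ι : Type*} [Fintype ι] [DecidableEq ι] (g : (ι → ℝ) → ℝ) : ℝ≥0∞ :=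
  ⨆ (P : BoxIntegral.Prepartition (unitBox ι)) (_ : P.IsPartition),
    ∑ J ∈ P.boxes, ‖boxDiff g J‖ₑ

/-- The point of the cube whose coordinates in `S` are `z`, and whose other coordinates are
`1` on `T` and `0` off `T`. For fixed `S` and `T ⊆ Sᶜ` these points form a face of the cube. -/
def facePoint {ι : Type*} [DecidableEq ι] (S T : Finset ι) (z : S → ℝ) : ι → ℝ :=
  fun j => if h : j ∈ S then z ⟨j, h⟩ else if j ∈ T then 1 else 0

/-- The Hardy–Krause variation of `g` on the unit cube: the sum of the Vitali variations of the
restrictions of `g` to all faces of the cube of dimension at least one. -/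
def hkVariation {ι : Type*} [Fintype ι] [DecidableEq ι] (g : (ι → ℝ) → ℝ) : ℝ≥0∞ :=
  ∑ S : Finset ι with S.Nonempty, ∑ T ∈ Sᶜ.powerset,
    vitaliVariation (fun z : S → ℝ => g (facePoint S T z))

/-- The Hardy–Krause variation over `[0,1]^S` of a function `g` that only depends on the
variables in `S` (the values given to the other variables are then immaterial). -/
def hkVariationOn {ι : Type*} [DecidableEq ι] (S : Finset ι) (g : (ι → ℝ) → ℝ) : ℝ≥0∞ :=
  hkVariation (fun z : S → ℝ => g (facePoint S ∅ z))

/-- The supremum of `|g|` over the unit cube. -/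
def cubeSup {ι : Type*} (g : (ι → ℝ) → ℝ) : ℝ≥0∞ :=
  ⨆ x ∈ Icc (0 : ι → ℝ) 1, ‖g x‖ₑ

/-- The empirical distribution function of the points `a 0, …, a (n-1)`. -/
def empiricalCDF {ι : Type*} [Fintype ι] {n : ℕ} (a : Fin n → ι → ℝ) (x : ι → ℝ) : ℝ :=
  ((Finset.univ.filter fun i => ∀ j, a i j ≤ x j).card : ℝ) / n

/-- The `L_∞` (star) discrepancy of the points `a 0, …, a (n-1)` of the unit cube. -/
def discrepancy {ι : Type*} [Fintype ι] {n : ℕ} (a : Fin n → ι → ℝ) : ℝ≥0∞ :=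
  cubeSup (fun x : ι → ℝ => empiricalCDF a x - ∏ j, x j)

/-- The discrepancy of the projections of the points `a i` to the coordinates in `S`. -/
def discrepancyOn {ι : Type*} {n : ℕ} (a : Fin n → ι → ℝ) (S : Finset ι) : ℝ≥0∞ :=
  discrepancy (fun i (j : S) => a i j)

/-! ### Best linear approximation and least squares -/

/-- The affine function `x ↦ b₀ + b' x`. -/
def affine {p : ℕ} (b : ℝ × (Fin p → ℝ)) (x : Fin p → ℝ) : ℝ := b.1 + ∑ j, b.2 j * x j

/-- `b = (b₀, (b_j)_j)` is the coefficient vector, padded by `0` off `A`, of a best `L²([0,1]^p)`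
approximation of `f` by affine functions of the variables in `A`. -/
def IsBLA {p : ℕ} (f : (Fin p → ℝ) → ℝ) (A : Finset (Fin p)) (b : ℝ × (Fin p → ℝ)) : Prop :=
  (∀ j, j ∉ A → b.2 j = 0) ∧
    ∀ c : ℝ × (Fin p → ℝ), (∀ j, j ∉ A → c.2 j = 0) →
      ∫ x in Icc (0 : Fin p → ℝ) 1, (f x - affine b x) ^ 2 ≤
        ∫ x in Icc (0 : Fin p → ℝ) 1, (f x - affine c x) ^ 2

open Classical in
/-- The padded coefficients `(β₀(A), β_{Z_p}(A))` of the best linear approximation of `f` by the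
variables in `A` (it exists and is unique for `f` continuous on the cube). -/
def bla {p : ℕ} (f : (Fin p → ℝ) → ℝ) (A : Finset (Fin p)) : ℝ × (Fin p → ℝ) :=
  if h : ∃ b, IsBLA f A b then h.choose else 0

/-- The matrix `(1_n, X_A)`; the column indexed by `none` is the intercept. -/
def augDesign {n p : ℕ} (X : Matrix (Fin n) (Fin p) ℝ) (A : Finset (Fin p)) :
    Matrix (Fin n) (Option A) ℝ :=
  Matrix.of fun i o => o.elim 1 (fun j => X i j)

/-- The least squares estimator `((1_n, X_A)' (1_n, X_A))⁻¹ (1_n, X_A)' y`. -/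
def lsEstimator {n p : ℕ} (X : Matrix (Fin n) (Fin p) ℝ) (y : Fin n → ℝ) (A : Finset (Fin p)) :
    Option A → ℝ :=
  Matrix.mulVec ((augDesign X A).transpose * augDesign X A)⁻¹
    (Matrix.mulVec (augDesign X A).transpose y)

/-- The least squares coefficients, padded by `0` off `A`. -/
def lsCoeff {n p : ℕ} (X : Matrix (Fin n) (Fin p) ℝ) (y : Fin n → ℝ) (A : Finset (Fin p)) :
    ℝ × (Fin p → ℝ) :=
  (lsEstimator X y A none,
    fun j => if h : j ∈ A then lsEstimator X y A (some ⟨j, h⟩) else 0)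

/-- The residual sum of squares of the least squares fit with the variables in `A`. -/
def rss {n p : ℕ} (X : Matrix (Fin n) (Fin p) ℝ) (y : Fin n → ℝ) (A : Finset (Fin p)) : ℝ :=
  ∑ i, (y i - affine (lsCoeff X y A) (X i)) ^ 2

/-! ### The screening problem with `n` runs -/

/-- The data of the screening problem with `n` runs: the number `p` of inputs, the number
`p₀ < p` of active inputs (the first `p₀` ones), the size `M ≥ p₀` of the screened subsets, the
simulator `f`, its approximation `fTilde` in the first `p₀` inputs, the approximation level `η`,
and the design sites (the rows of `X`). -/
structure Experiment (n : ℕ) where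
  p : ℕ
  p₀ : ℕ
  M : ℕ
  f : (Fin p → ℝ) → ℝ
  fTilde : (Fin p₀ → ℝ) → ℝ
  η : ℝ
  X : Matrix (Fin n) (Fin p) ℝ
  p₀_lt_p : p₀ < p
  p₀_le_M : p₀ ≤ M
  f_continuous : ContinuousOn f (Icc 0 1)
  X_mem : ∀ i j, X i j ∈ Ico (0 : ℝ) 1

namespace Experiment

variable {n : ℕ} (E : Experiment n)

/-- The outputs `y_i = f(x_i)`. -/
def y : Fin n → ℝ := fun i => E.f (E.X i)

/-- The active set: the first `p₀` inputs. -/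
def A₀ : Finset (Fin E.p) := Finset.univ.filter fun j => (j : ℕ) < E.p₀

/-- `fTilde` as a function of all inputs, `x ↦ fTilde(x_1, …, x_{p₀})`. -/
def fT (x : Fin E.p → ℝ) : ℝ := E.fTilde fun j => x (Fin.castLE E.p₀_lt_p.le j)

/-- The simulator is nearly sparse with signal `τ`. -/
structure NearlySparse (τ : ℝ) : Prop where
  fTilde_continuous : ContinuousOn E.fTilde (Icc 0 1)
  η_pos : 0 < E.η
  approx : cubeSup (fun x => E.f x - E.fT x) < ENNReal.ofReal E.η
  signal : ∀ j ∈ E.A₀,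
    τ < |(∫ x in Icc (0 : Fin E.p → ℝ) 1, x j * E.f x)
      - 1 / 2 * ∫ x in Icc (0 : Fin E.p → ℝ) 1, E.f x|

/-- The subsets of size `M` that contain the active set. -/
def U₀ : Finset (Finset (Fin E.p)) := Finset.univ.filter fun A => A.card = E.M ∧ E.A₀ ⊆ A

/-- The subsets of size `M` that miss some active input. -/
def U₁ : Finset (Finset (Fin E.p)) :=
  Finset.univ.filter fun A => A.card = E.M ∧ (E.A₀ \ A).Nonempty

/-- The subsets of size `2`. -/
def U₂ : Finset (Finset (Fin E.p)) := Finset.univ.filter fun A => A.card = 2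

/-- The unions of the active set with one further input. -/
def U₃ : Finset (Finset (Fin E.p)) :=
  Finset.univ.filter fun A => ∃ I ⊆ E.A₀ᶜ, I.card = 1 ∧ A = E.A₀ ∪ I

/-- The unions of the active set with `M - 1` further inputs. -/
def U₄ : Finset (Finset (Fin E.p)) :=
  Finset.univ.filter fun A => ∃ I ⊆ E.A₀ᶜ, I.card = E.M - 1 ∧ A = E.A₀ ∪ I

/-- `Δ_{p₀,n}`. -/
def Δp₀ : ℝ≥0∞ := discrepancyOn E.X E.A₀

/-- `Δ_{2,n}`. -/
def Δ₂ : ℝ≥0∞ := E.U₂.sup (discrepancyOn E.X)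

/-- `Δ_{p₀+1,n}`. -/
def Δp₀1 : ℝ≥0∞ := E.U₃.sup (discrepancyOn E.X)

/-- `Δ_{p₀+M-1,n}`. -/
def Δp₀M : ℝ≥0∞ := E.U₄.sup (discrepancyOn E.X)

/-- The residual function `x ↦ fTilde(x_{A₀}) - β₀(A) - β_{Z_p}(A)' x`. -/
def blaResidual (A : Finset (Fin E.p)) (x : Fin E.p → ℝ) : ℝ := E.fT x - affine (bla E.f A) x

/-- `C_{1n}`; the function `x_j fTilde(x_{A₀})` is one of the variables in `A₀ ∪ {j}`. -/
def C₁ : ℝ≥0∞ :=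
  max (hkVariation E.fTilde)
    (Finset.univ.sup fun j => hkVariationOn (insert j E.A₀) fun x => x j * E.fT x)

/-- `C_{2n}`. -/
def C₂ : ℝ≥0∞ := cubeSup E.f

/-- `C_{3n}`. -/
def C₃ : ℝ≥0∞ := cubeSup (E.blaResidual E.A₀)

/-- `C_{4n}`. -/
def C₄ : ℝ≥0∞ := E.U₁.sup fun A => cubeSup (E.blaResidual A)

/-- `V_{1n}`. -/
def V₁ : ℝ≥0∞ := hkVariationOn E.A₀ (E.blaResidual E.A₀)

/-- `V_{2n}`; the residual function for `A` is one of the variables in `A₀ ∪ A`. -/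
def V₂ : ℝ≥0∞ := E.U₁.sup fun A => hkVariationOn (E.A₀ ∪ A) (E.blaResidual A)

/-- The common form of `ζ_{1n}` (with `m = p₀`, `Δ = Δ_{p₀,n}`) and of `ζ_{2n}` (with `m = M`,
`Δ = Δ_{p₀+1,n}`). -/
def ζ (α : ℝ) (m : ℕ) (Δ : ℝ≥0∞) : ℝ≥0∞ :=
  E.C₁ * (m + 1) ^ 2 * (9 * m + 1) * Δ
    + 2 * (m + 1) ^ 2 * (9 * m + 1) * ENNReal.ofReal E.η
    + ENNReal.ofReal (3 / (1 - α)) * E.C₂ * (m + 1) ^ 4 * (9 * m + 1) ^ 2 * E.Δ₂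

/-- `ζ_{1n}`. -/
def ζ₁ (α : ℝ) : ℝ≥0∞ := E.ζ α E.p₀ E.Δp₀

/-- `ζ_{2n}`. -/
def ζ₂ (α : ℝ) : ℝ≥0∞ := E.ζ α E.M E.Δp₀1

/-- `ρ_{1n}`. -/
def ρ₁ (α : ℝ) : ℝ≥0∞ :=
  E.ζ₁ α ^ 2 + 2 * (E.C₃ + ENNReal.ofReal E.η) * E.ζ₁ α
    + 2 * ((E.p₀ : ℝ≥0∞) + 1) ^ (-(1 / 2) : ℝ) * E.ζ₁ α ^ 2

/-- `ρ_{2n}`. -/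
def ρ₂ (α : ℝ) : ℝ≥0∞ :=
  E.ζ₂ α ^ 2 + 2 * (E.C₄ + ENNReal.ofReal E.η) * E.ζ₂ α
    + 2 * ((E.M : ℝ≥0∞) + 1) ^ (-(1 / 2) : ℝ) * E.ζ₂ α ^ 2

/-- The sum of all the (nonnegative) terms subtracted from `12 τ²` in the signal condition. -/
def penalty (α : ℝ) : ℝ≥0∞ :=
  ENNReal.ofReal (12 * ((E.M : ℝ) - E.p₀ + 1) * E.η ^ 2) + ENNReal.ofReal (4 * E.η ^ 2)
    + 4 * ENNReal.ofReal E.η * (E.C₄ + E.C₃)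
    + E.Δp₀ * E.V₁ + E.Δp₀M * E.V₂ + E.ρ₁ α + E.ρ₂ α

end Experiment

end

end LinearScreening

set_option linter.unusedSectionVars false

namespace LinearScreening

open MeasureTheory

/-! ### Abel summation on a grid -/

/-! On the cube the functions `1` and `x_j - 1/2` are orthogonal (`integral_centred_mul`), so the
coefficient of a coordinate in the `L²` projection of `f` is the same for every set of variables. At
population level, missing an active input therefore costs `12 ⟨f, x_j - 1/2⟩² > 12 τ²`, while an
inactive input contributes at most `3 η²`: reflecting its coordinate shows that `fT` is orthogonal
to it.

Sample means replace integrals through `dev`. A Koksma–Hlawka inequality,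
`enorm_dev_le_hkVariation`, bounds `dev` for `fT` and `x_j fT`; products of centred coordinates have
error at most `2 Δ₂`. Hence the empirical Gram matrix keeps 7/9 of the population one
(`le_mean_combo_sq`), and all residual-times-coordinate errors are bounded by one `ε`.

The two sums of squares are compared without estimating fitted coefficients. As `A` contains `A₀`,
its fit beats the projection on `A₀` (`rss_le_sum_sq`). No fit on `A₁` improves on the projection on
`A₁` by more than order `ε²` (`mean_sq_sub_proj_le`). The two projections are separated by
`le_mean_sq_sub_proj_sub`, where only coordinates in the symmetric difference appear. The signal
condition enters through `ζ₂² + 2 (C₄ + η) ζ₂ ≤ ρ₂ ≤ penalty`, and `error_terms_le` shows that this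
dominates every error. -/

lemma sum_fin_succ_sub_castSucc {N : ℕ} (ψ : Fin (N + 1) → ℝ) :
    ∑ l : Fin N, (ψ l.succ - ψ l.castSucc) = ψ (Fin.last N) - ψ 0 := by
  have h1 := Fin.sum_univ_succ ψ
  have h2 := Fin.sum_univ_castSucc ψ
  rw [Finset.sum_sub_distrib]
  linarith

lemma abel_one {N : ℕ} (φ : Fin (N + 1) → ℝ) (k : Fin (N + 1)) :
    φ k = (∑ l : Fin N, -(if k ≤ l.castSucc then (1 : ℝ) else 0) *
      (φ l.succ - φ l.castSucc)) + φ (Fin.last N) := by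
  -- Telescoping `i ↦ φ (max i k)` kills the increments below `k`, so the sum runs from `k` to the
  -- last index.
  have h := sum_fin_succ_sub_castSucc (fun i => φ (max i k))
  have h' : ∀ l : Fin N, -(if k ≤ l.castSucc then (1 : ℝ) else 0) * (φ l.succ - φ l.castSucc)
      = -(φ (max l.succ k) - φ (max l.castSucc k)) := by
    intro l
    split_ifs with hl
    · rw [max_eq_left hl, max_eq_left (hl.trans (Fin.castSucc_lt_succ).le)]
      ring
    · have h1 : l.succ ≤ k := by
        rw [not_le] at hl
        exact Fin.castSucc_lt_iff_succ_le.mp hl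
      rw [max_eq_right (not_le.mp hl).le, max_eq_right h1]
      ring
  simp only [h', Finset.sum_neg_distrib, h, max_eq_left (Fin.le_last k),
    max_eq_right (Fin.zero_le k)]
  ring

/-- The grid vertex with index `l` or `l + 1` in the coordinates in `S` (`l` on `T`), and with the
last index in the other coordinates. -/
def gridVertex {ι : Type*} [DecidableEq ι] {N : ℕ} (S : Finset ι) (l : S → Fin N)
    (T : Finset S) : ι → Fin (N + 1) :=
  fun j => if hj : j ∈ S then (if (⟨j, hj⟩ : S) ∈ T then (l ⟨j, hj⟩).castSucc
    else (l ⟨j, hj⟩).succ) else Fin.last N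

/-- Multiply `abel_one` over the coordinates: `S` records where the increment is chosen rather than
the terminal value, and `T` expands the product of increments over the vertices of a cell. -/
lemma abel_prod {ι : Type*} [Fintype ι] [DecidableEq ι] {N : ℕ} (φ : ι → Fin (N + 1) → ℝ)
    (k : ι → Fin (N + 1)) :
    ∏ j, φ j (k j) = ∑ S : Finset ι, ∑ l : S → Fin N,
      (∏ j : S, -(if k j ≤ (l j).castSucc then (1 : ℝ) else 0)) *
        ∑ T : Finset S, (-1 : ℝ) ^ T.card * ∏ j, φ j (gridVertex S l T j) := by
  rw [Finset.prod_congr rfl (fun j _ => abel_one (φ j) (k j)), Fintype.prod_add]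
  refine Finset.sum_congr rfl fun S _ => ?_
  rw [← Finset.prod_coe_sort S, Finset.prod_univ_sum, Fintype.piFinset_univ, Finset.sum_mul]
  refine Finset.sum_congr rfl fun l _ => ?_
  rw [Finset.prod_mul_distrib, Finset.prod_sub, mul_assoc, Finset.sum_mul]
  congr 1
  rw [Finset.powerset_univ]
  refine Finset.sum_congr rfl fun T _ => ?_
  rw [← Finset.prod_mul_prod_compl S, ← Finset.prod_coe_sort S, mul_assoc, mul_assoc]
  congr 1
  rw [← mul_assoc]
  congr 1
  · rw [← Finset.compl_eq_univ_sdiff, mul_comm, ← Finset.prod_mul_prod_compl T]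
    congr 1
    · refine Finset.prod_congr rfl fun j hj => ?_
      simp [gridVertex, hj]
    · refine Finset.prod_congr rfl fun j hj => ?_
      simp [gridVertex, Finset.mem_compl.mp hj]
  · refine Finset.prod_congr rfl fun j hj => ?_
    simp [gridVertex, Finset.mem_compl.mp hj]

/-- Multivariate Abel summation. -/
lemma abel_grid {ι : Type*} [Fintype ι] [DecidableEq ι] {N : ℕ} (h : (ι → Fin (N + 1)) → ℝ)
    (k : ι → Fin (N + 1)) :
    h k = ∑ S : Finset ι, ∑ l : S → Fin N,
      (∏ j : S, -(if k j ≤ (l j).castSucc then (1 : ℝ) else 0)) *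
        ∑ T : Finset S, (-1 : ℝ) ^ T.card * h (gridVertex S l T) := by
  -- The identity is linear in `h`, and every function on the grid is a combination of products of
  -- point indicators, so `abel_prod` suffices.
  have key : ∀ q : ι → Fin (N + 1),
      h q = ∑ a : ι → Fin (N + 1), h a * ∏ j, (if a j = q j then (1 : ℝ) else 0) := by
    intro q
    rw [Finset.sum_eq_single q]
    · simp
    · intro b _ hb
      obtain ⟨j, hj⟩ := Function.ne_iff.mp hb
      rw [Finset.prod_eq_zero (Finset.mem_univ j) (if_neg hj), mul_zero]
    · simp
  rw [key k]
  simp_rw [fun a : ι → Fin (N + 1) =>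
    abel_prod (fun j q => if a j = q then (1 : ℝ) else 0) k, Finset.mul_sum]
  rw [Finset.sum_comm]
  refine Finset.sum_congr rfl fun S _ => ?_
  rw [Finset.sum_comm]
  refine Finset.sum_congr rfl fun l _ => ?_
  rw [Finset.sum_comm]
  refine Finset.sum_congr rfl fun T _ => ?_
  rw [key (gridVertex S l T), Finset.mul_sum, Finset.mul_sum]
  refine Finset.sum_congr rfl fun a _ => ?_
  ring

/-! ### The variation on the regular grid -/

/-- The regular grid box with lower vertex `l / N`. -/
noncomputable def gridBox {ι : Type*} (N : ℕ) [NeZero N] (l : ι → Fin N) : BoxIntegral.Box ι :=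
  BoxIntegral.unitPartition.box N (fun i => ((l i : ℕ) : ℤ))

/-- The cells belong to one particular partition, over which the supremum is taken. Inclusion is
enough because the summands are nonnegative. -/
lemma sum_gridBox_le_vitaliVariation {ι : Type*} [Fintype ι] [DecidableEq ι] (N : ℕ) [NeZero N]
    (g : (ι → ℝ) → ℝ) :
    ∑ l : ι → Fin N, ‖boxDiff g (gridBox N l)‖ₑ ≤ vitaliVariation g := by
  classical
  have hB : BoxIntegral.hasIntegralVertices (unitBox ι) :=
    ⟨0, 1, fun i => by simp [unitBox], fun i => by simp [unitBox]⟩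
  have hN : (0 : ℝ) < N := Nat.cast_pos.mpr (NeZero.pos N)
  refine le_trans ?_ (le_iSup₂ (f := fun (P : BoxIntegral.Prepartition (unitBox ι))
    (_ : P.IsPartition) => ∑ J ∈ P.boxes, ‖boxDiff g J‖ₑ)
    (BoxIntegral.unitPartition.prepartition N (unitBox ι)).toPrepartition
    (BoxIntegral.unitPartition.prepartition_isPartition N hB))
  have hinj : Function.Injective (gridBox N : (ι → Fin N) → BoxIntegral.Box ι) := by
    intro l l' h
    have := BoxIntegral.unitPartition.box_injective N h
    funext i
    have hi := congrFun this i
    simp only [Nat.cast_inj] at hi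
    exact Fin.ext hi
  rw [← Finset.sum_image (s := Finset.univ) (g := gridBox N) (f := fun J => ‖boxDiff g J‖ₑ)
    (fun x _ y _ hxy => hinj hxy)]
  refine Finset.sum_le_sum_of_subset fun J hJ => ?_
  obtain ⟨l, -, rfl⟩ := Finset.mem_image.mp hJ
  rw [BoxIntegral.unitPartition.mem_prepartition_boxes_iff]
  refine ⟨_, ?_, rfl⟩
  rw [BoxIntegral.unitPartition.mem_admissibleIndex_iff, BoxIntegral.Box.le_iff_bounds]
  constructor
  · intro i
    simp only [unitBox, BoxIntegral.unitPartition.box_lower, Pi.zero_apply]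
    positivity
  · intro i
    simp only [unitBox, BoxIntegral.unitPartition.box_upper, Pi.one_apply]
    rw [div_le_one hN]
    have := (l i).isLt
    exact_mod_cast this

/-! ### The integration error of a design -/

/-- The error of approximating the integral of `G` over the cube by the mean over the design. -/
noncomputable def dev {κ : Type} [Fintype κ] {n : ℕ} (a : Fin n → κ → ℝ) (G : (κ → ℝ) → ℝ) : ℝ :=
  (∑ i, G (a i)) / n - ∫ x in Icc (0 : κ → ℝ) 1, G x

/-- The indicator function of the orthant with upper corner `t`. -/
noncomputable def orthant {κ : Type} (t : κ → ℝ) : (κ → ℝ) → ℝ := (Iic t).indicator fun _ => 1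

section Dev

variable {κ : Type} [Fintype κ] {n : ℕ}

lemma volume_cube : volume (Icc (0 : κ → ℝ) 1) = 1 := by
  simp [Real.volume_Icc_pi]

lemma integrableOn_const_cube (c : ℝ) : IntegrableOn (fun _ : κ → ℝ => c) (Icc 0 1) := by
  refine integrableOn_const ?_
  simp [volume_cube]

lemma abs_integral_cube_le {G : (κ → ℝ) → ℝ} {c : ℝ} (h : ∀ x ∈ Icc (0 : κ → ℝ) 1, |G x| ≤ c) :
    |∫ x in Icc (0 : κ → ℝ) 1, G x| ≤ c := by
  have := norm_setIntegral_le_of_norm_le_const (μ := volume) (f := G) (s := Icc (0 : κ → ℝ) 1)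
    (C := c) (by simp [volume_cube]) h
  simpa [Measure.real, volume_cube] using this

variable (a : Fin n → κ → ℝ)

lemma dev_add {F G : (κ → ℝ) → ℝ} (hF : IntegrableOn F (Icc 0 1)) (hG : IntegrableOn G (Icc 0 1)) :
    dev a (fun x => F x + G x) = dev a F + dev a G := by
  unfold dev
  rw [integral_add hF hG, Finset.sum_add_distrib]
  ring

lemma dev_const_mul (c : ℝ) (G : (κ → ℝ) → ℝ) : dev a (fun x => c * G x) = c * dev a G := by
  unfold dev
  rw [integral_const_mul, ← Finset.mul_sum]
  ring

lemma dev_sub {F G : (κ → ℝ) → ℝ} (hF : IntegrableOn F (Icc 0 1)) (hG : IntegrableOn G (Icc 0 1)) :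
    dev a (fun x => F x - G x) = dev a F - dev a G := by
  unfold dev
  rw [integral_sub hF hG, Finset.sum_sub_distrib]
  ring

lemma dev_sum {σ : Type} (s : Finset σ) {G : σ → (κ → ℝ) → ℝ}
    (hG : ∀ i ∈ s, IntegrableOn (G i) (Icc 0 1)) :
    dev a (fun x => ∑ i ∈ s, G i x) = ∑ i ∈ s, dev a (G i) := by
  unfold dev
  rw [integral_finsetSum s hG, Finset.sum_comm, Finset.sum_sub_distrib, Finset.sum_div]

lemma dev_const (hn : 0 < n) (c : ℝ) : dev a (fun _ => c) = 0 := by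
  have : (n : ℝ) ≠ 0 := by positivity
  simp [dev, Measure.real, volume_cube, this]

variable {a}

lemma abs_dev_le (hn : 0 < n) (ha : ∀ i j, a i j ∈ Ico (0 : ℝ) 1) {G : (κ → ℝ) → ℝ} {c : ℝ}
    (h : ∀ x ∈ Icc (0 : κ → ℝ) 1, |G x| ≤ c) : |dev a G| ≤ 2 * c := by
  have h1 := abs_integral_cube_le h
  have hn' : (0 : ℝ) < n := Nat.cast_pos.mpr hn
  have h2 : |(∑ i, G (a i)) / n| ≤ c := by
    rw [abs_div, Nat.abs_cast, div_le_iff₀ hn']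
    refine (Finset.abs_sum_le_sum_abs _ _).trans ?_
    refine (Finset.sum_le_sum fun i _ => h (a i) ⟨fun j => (ha i j).1, fun j => (ha i j).2.le⟩).trans ?_
    simp [mul_comm]
  unfold dev
  have := abs_sub ((∑ i, G (a i)) / n) (∫ x in Icc (0 : κ → ℝ) 1, G x)
  linarith

lemma integrableOn_orthant (t : κ → ℝ) : IntegrableOn (orthant t) (Icc 0 1) :=
  (integrableOn_const_cube 1).indicator measurableSet_Iic

/-- A bound `x_j ≤ 1` is vacuous for design points and contributes a factor 1 to the volume, so the
error is exactly the local discrepancy of the projected design at `t`. -/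
lemma enorm_dev_orthant_le (ha : ∀ i j, a i j ∈ Ico (0 : ℝ) 1) (S : Finset κ)
    {t : κ → ℝ} (ht : t ∈ Icc (0 : κ → ℝ) 1) (htS : ∀ j ∉ S, t j = 1) :
    ‖dev a (orthant t)‖ₑ ≤ discrepancyOn a S := by
  classical
  have h1 : ∫ x in Icc (0 : κ → ℝ) 1, orthant t x = ∏ j : S, t j := by
    unfold orthant
    rw [setIntegral_indicator measurableSet_Iic]
    have : Icc (0 : κ → ℝ) 1 ∩ Iic t = Icc 0 t := by
      ext x
      simp only [mem_inter_iff, mem_Icc, mem_Iic]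
      exact ⟨fun h => ⟨h.1.1, h.2⟩, fun h => ⟨⟨h.1, h.2.trans ht.2⟩, h.2⟩⟩
    rw [this, setIntegral_const, Measure.real, Real.volume_Icc_pi_toReal ht.1]
    simp only [Pi.zero_apply, sub_zero, smul_eq_mul, mul_one]
    rw [Finset.prod_coe_sort S t]
    exact (Finset.prod_subset (Finset.subset_univ S) (fun j _ hj => htS j hj)).symm
  have h2 : dev a (orthant t) = empiricalCDF (fun i (j : S) => a i j) (fun j : S => t j)
      - ∏ j : S, t j := by
    unfold dev empiricalCDF
    rw [h1]
    congr 2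
    rw [Finset.card_filter]
    push_cast
    refine Finset.sum_congr rfl fun i _ => ?_
    unfold orthant
    rw [indicator_apply]
    refine if_congr ?_ rfl rfl
    rw [mem_Iic, Pi.le_def]
    refine ⟨fun h j => h j, fun h j => ?_⟩
    by_cases hj : j ∈ S
    · exact h ⟨j, hj⟩
    · rw [htS j hj]
      exact (ha i j).2.le
  rw [h2]
  exact le_iSup₂ (f := fun (x : S → ℝ) (_ : x ∈ Icc (0 : S → ℝ) 1) =>
    ‖empiricalCDF (fun i (j : S) => a i j) x - ∏ j, x j‖ₑ) (fun j : S => t j)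
    ⟨fun j => ht.1 j, fun j => ht.2 j⟩

/-- `G` is a uniform limit on the cube of functions `c + ∑ w_i 1[x ≤ t_i]` with `∑ |w_i| ≤ V`,
where the corners `t_i` only constrain the coordinates in `S`. -/
def OrthantApprox (S : Finset κ) (V : ℝ≥0∞) (G : (κ → ℝ) → ℝ) : Prop :=
  ∀ ε : ℝ, 0 < ε → ∃ (σ : Type) (s : Finset σ) (c : ℝ) (w : σ → ℝ) (t : σ → κ → ℝ),
    (∀ i ∈ s, t i ∈ Icc (0 : κ → ℝ) 1 ∧ ∀ j ∉ S, t i j = 1) ∧ ∑ i ∈ s, ‖w i‖ₑ ≤ V ∧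
      ∀ x ∈ Icc (0 : κ → ℝ) 1, |G x - (c + ∑ i ∈ s, w i * orthant (t i) x)| ≤ ε

/-- `dev` is linear and kills constants, each orthant costs at most the discrepancy, and a uniform
error costs at most twice its size; hence the tolerance `ε / 2` in the proof. -/
lemma OrthantApprox.enorm_dev_le (hn : 0 < n) (ha : ∀ i j, a i j ∈ Ico (0 : ℝ) 1) {S : Finset κ}
    {V : ℝ≥0∞} {G : (κ → ℝ) → ℝ} (h : OrthantApprox S V G) (hG : IntegrableOn G (Icc 0 1)) :
    ‖dev a G‖ₑ ≤ V * discrepancyOn a S := by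
  refine _root_.le_of_forall_pos_le_add fun ε hε => ?_
  rcases eq_or_ne ε ⊤ with rfl | hεt
  · simp
  have hε' : 0 < ε.toReal / 2 := half_pos (ENNReal.toReal_pos hε.ne' hεt)
  obtain ⟨σ, s, c, w, t, ht, hw, happ⟩ := h _ hε'
  have hi : ∀ i ∈ s, IntegrableOn (fun x => w i * orthant (t i) x) (Icc (0 : κ → ℝ) 1) :=
    fun i _ => (integrableOn_orthant (t i)).const_mul _
  have hsum : IntegrableOn (fun x => ∑ i ∈ s, w i * orthant (t i) x) (Icc (0 : κ → ℝ) 1) :=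
    integrable_finsetSum s hi
  have hH : IntegrableOn (fun x => c + ∑ i ∈ s, w i * orthant (t i) x) (Icc (0 : κ → ℝ) 1) :=
    (integrableOn_const_cube c).add hsum
  have h1 : dev a G = dev a (fun x => c + ∑ i ∈ s, w i * orthant (t i) x) +
      dev a (fun x => G x - (c + ∑ i ∈ s, w i * orthant (t i) x)) := by
    rw [dev_sub a hG hH]
    ring
  have h2 : dev a (fun x => c + ∑ i ∈ s, w i * orthant (t i) x) =
      ∑ i ∈ s, w i * dev a (orthant (t i)) := by
    rw [dev_add a (integrableOn_const_cube c) hsum, dev_const a hn, dev_sum a s hi, zero_add]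
    exact Finset.sum_congr rfl fun i _ => dev_const_mul a _ _
  rw [h1, h2]
  refine (enorm_add_le _ _).trans (add_le_add ?_ ?_)
  · refine (enorm_sum_le _ _).trans ?_
    calc ∑ i ∈ s, ‖w i * dev a (orthant (t i))‖ₑ
        ≤ ∑ i ∈ s, ‖w i‖ₑ * discrepancyOn a S := by
          refine Finset.sum_le_sum fun i hi' => ?_
          rw [enorm_mul]
          gcongr
          exact enorm_dev_orthant_le ha S (ht i hi').1 (ht i hi').2
      _ ≤ V * discrepancyOn a S := by
          rw [← Finset.sum_mul]
          gcongr
  · have h3 := abs_dev_le hn ha happ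
    rw [Real.enorm_eq_ofReal_abs, ENNReal.ofReal_le_iff_le_toReal hεt]
    linarith

end Dev

/-! ### The Koksma–Hlawka inequality -/

section KoksmaHlawka

variable {ι κ : Type} [Fintype ι] [DecidableEq ι] [Fintype κ]

/-- The upper corner of the orthant that bounds the coordinates `e j`, `j ∈ S`, by `l j / N`. -/
noncomputable def gridCorner (e : ι → κ) {N : ℕ} (S : Finset ι) (l : S → Fin N) : κ → ℝ :=
  Function.extend e (fun j => if hj : j ∈ S then (l ⟨j, hj⟩ : ℝ) / N else 1) 1

lemma orthant_gridCorner {e : ι → κ} (he : Function.Injective e) {N : ℕ} [NeZero N] (S : Finset ι)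
    (l : S → Fin N) {x : κ → ℝ} (hx : x ∈ Icc (0 : κ → ℝ) 1) :
    orthant (gridCorner e S l) x = ∏ j : S, (if x (e j) ≤ (l j : ℝ) / N then (1 : ℝ) else 0) := by
  classical
  rw [Finset.prod_ite_zero, Finset.prod_const_one]
  unfold orthant
  rw [indicator_apply]
  congr 1
  rw [mem_Iic, Pi.le_def, eq_iff_iff]
  constructor
  · intro h j _
    have := h (e j)
    rw [gridCorner, he.extend_apply] at this
    simpa using this
  · intro h k
    by_cases hk : ∃ j, e j = k
    · obtain ⟨j, rfl⟩ := hk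
      rw [gridCorner, he.extend_apply]
      split_ifs with hj
      · exact h ⟨j, hj⟩ (Finset.mem_univ _)
      · exact hx.2 (e j)
    · rw [gridCorner, Function.extend_apply' _ _ _ hk]
      exact hx.2 k

lemma gridCorner_mem {e : ι → κ} (he : Function.Injective e) {N : ℕ} [NeZero N] (S : Finset ι)
    (l : S → Fin N) : gridCorner e S l ∈ Icc (0 : κ → ℝ) 1 := by
  have hN : (0 : ℝ) < N := Nat.cast_pos.mpr (NeZero.pos N)
  have h : ∀ k, 0 ≤ gridCorner e S l k ∧ gridCorner e S l k ≤ 1 := by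
    intro k
    by_cases hk : ∃ j, e j = k
    · obtain ⟨j, rfl⟩ := hk
      rw [gridCorner, he.extend_apply]
      split_ifs with hj
      · refine ⟨by positivity, ?_⟩
        rw [div_le_one hN]
        exact_mod_cast (l ⟨j, hj⟩).isLt.le
      · simp
    · rw [gridCorner, Function.extend_apply' _ _ _ hk]
      simp
  exact ⟨fun k => (h k).1, fun k => (h k).2⟩

lemma gridCorner_eq_one {e : ι → κ} {N : ℕ} (S : Finset ι) (l : S → Fin N) {k : κ}
    (hk : k ∉ range e) : gridCorner e S l k = 1 := by
  rw [gridCorner, Function.extend_apply' _ _ _ hk]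
  rfl

/-- Abel summation freezes the coordinates off `S` at the last index, that is at the value `N / N =
1`, so only the faces with `T = Sᶜ` occur. -/
lemma boxDiff_facePoint_gridBox {N : ℕ} [NeZero N] (g : (ι → ℝ) → ℝ) (S : Finset ι)
    (l : S → Fin N) :
    boxDiff (fun z : S → ℝ => g (facePoint S Sᶜ z)) (gridBox N l) =
      ∑ T : Finset S, (-1 : ℝ) ^ T.card *
        g (fun j => ((gridVertex S l T j : ℕ) : ℝ) / N) := by
  have hN : (N : ℝ) ≠ 0 := Nat.cast_ne_zero.mpr (NeZero.ne N)
  unfold boxDiff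
  refine Finset.sum_congr rfl fun T _ => ?_
  congr 1
  refine congrArg g (funext fun j => ?_)
  unfold facePoint gridVertex
  split_ifs with hj hT <;> simp_all [gridBox]

lemma sum_gridBox_le_hkVariation {N : ℕ} [NeZero N] (g : (ι → ℝ) → ℝ) :
    ∑ S : Finset ι with S.Nonempty, ∑ l : S → Fin N,
      ‖boxDiff (fun z : S → ℝ => g (facePoint S Sᶜ z)) (gridBox N l)‖ₑ ≤ hkVariation g := by
  refine Finset.sum_le_sum fun S _ => ?_
  refine (sum_gridBox_le_vitaliVariation N _).trans ?_
  exact Finset.single_le_sum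
    (f := fun T => vitaliVariation (fun z : S → ℝ => g (facePoint S T z)))
    (fun _ _ => zero_le) (Finset.mem_powerset_self Sᶜ)

/-- The index of the grid cell that contains `x`. -/
noncomputable def gridIndex (N : ℕ) (x : ℝ) : Fin (N + 1) := ⟨min ⌈N * x⌉₊ N, by omega⟩

/-- Rounding up turns the discrete indicators of Abel summation into indicators of closed
half-lines. The truncation at `N` is harmless because `l < N`. -/
lemma gridIndex_le_castSucc {N : ℕ} [NeZero N] (x : ℝ) (l : Fin N) :
    gridIndex N x ≤ l.castSucc ↔ x ≤ (l : ℝ) / N := by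
  have hN : (0 : ℝ) < N := Nat.cast_pos.mpr (NeZero.pos N)
  have hl := l.isLt
  rw [Fin.le_def, le_div_iff₀' hN, ← Nat.ceil_le]
  simp only [gridIndex, Fin.val_castSucc]
  omega

lemma abs_sub_gridIndex_le {N : ℕ} [NeZero N] {x : ℝ} (hx : x ∈ Icc (0 : ℝ) 1) :
    |x - ((gridIndex N x : ℕ) : ℝ) / N| ≤ 1 / N := by
  have hN : (0 : ℝ) < N := Nat.cast_pos.mpr (NeZero.pos N)
  have h1 : ⌈N * x⌉₊ ≤ N := by
    rw [Nat.ceil_le]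
    nlinarith [hx.2]
  have h2 := Nat.le_ceil (N * x)
  have h3 := Nat.ceil_lt_add_one (mul_nonneg hN.le hx.1)
  simp only [gridIndex, min_eq_left h1]
  have h4 : x - (⌈N * x⌉₊ : ℝ) / N = (N * x - ⌈N * x⌉₊) / N := by field_simp
  rw [h4, abs_div, abs_of_pos hN]
  gcongr
  rw [abs_le]
  constructor <;> linarith

lemma gridIndex_div_mem {N : ℕ} [NeZero N] (x : ℝ) :
    ((gridIndex N x : ℕ) : ℝ) / N ∈ Icc (0 : ℝ) 1 := by
  have hN : (0 : ℝ) < N := Nat.cast_pos.mpr (NeZero.pos N)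
  refine ⟨by positivity, ?_⟩
  rw [div_le_one hN]
  exact_mod_cast min_le_right _ _

lemma exists_one_div_lt_neZero {δ : ℝ} (hδ : 0 < δ) : ∃ N : ℕ, NeZero N ∧ (1 : ℝ) / N < δ := by
  obtain ⟨N, hN⟩ := exists_nat_one_div_lt hδ
  exact ⟨N + 1, ⟨N.succ_ne_zero⟩, by exact_mod_cast hN⟩

/-- By uniform continuity `g` is close to its value at the grid point obtained by rounding up. Abel
summation expresses that value by orthants whose weights are, up to sign, cell differences on the
upper faces; the Hardy–Krause variation bounds their total. -/
lemma orthantApprox_of_continuousOn {e : ι → κ} (he : Function.Injective e) {S' : Finset κ}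
    (heS : ∀ j, e j ∈ S') {g : (ι → ℝ) → ℝ} (hg : ContinuousOn g (Icc 0 1)) :
    OrthantApprox S' (hkVariation g) (fun x => g (fun j => x (e j))) := by
  intro ε hε
  have huc := isCompact_Icc.uniformContinuousOn_of_continuous hg
  obtain ⟨δ, hδ, hgδ⟩ := Metric.uniformContinuousOn_iff.mp huc ε hε
  obtain ⟨N, hN0, hNδ⟩ := exists_one_div_lt_neZero hδ
  have hN : (0 : ℝ) < N := Nat.cast_pos.mpr (NeZero.pos N)
  refine ⟨Σ S : Finset ι, (S → Fin N),
    (Finset.univ.filter fun S : Finset ι => S.Nonempty).sigma fun _ => Finset.univ,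
    -- Only `S = ∅` contributes here: the constant is the value of `g` at the all-ones vertex.
    ∑ S : Finset ι with ¬ S.Nonempty, ∑ l : S → Fin N,
      boxDiff (fun z : S → ℝ => g (facePoint S Sᶜ z)) (gridBox N l),
    fun q => (-1) ^ q.1.card *
      boxDiff (fun z : q.1 → ℝ => g (facePoint q.1 q.1ᶜ z)) (gridBox N q.2),
    fun q => gridCorner e q.1 q.2, ?_, ?_, ?_⟩
  · intro q _
    refine ⟨gridCorner_mem he q.1 q.2, fun j hj => gridCorner_eq_one q.1 q.2 ?_⟩
    rintro ⟨i, rfl⟩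
    exact hj (heS i)
  · rw [Finset.sum_sigma]
    refine le_trans (le_of_eq ?_) (sum_gridBox_le_hkVariation (N := N) g)
    refine Finset.sum_congr rfl fun S _ => Finset.sum_congr rfl fun l _ => ?_
    simp [enorm_mul]
  · intro x hx
    have hmem : ∀ j, x (e j) ∈ Icc (0 : ℝ) 1 := fun j => ⟨hx.1 (e j), hx.2 (e j)⟩
    have habel := abel_grid (fun q : ι → Fin (N + 1) => g (fun j => ((q j : ℕ) : ℝ) / N))
      (fun j => gridIndex N (x (e j)))
    simp_rw [← boxDiff_facePoint_gridBox, gridIndex_le_castSucc] at habel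
    have hrepr : (∑ S : Finset ι with ¬ S.Nonempty, ∑ l : S → Fin N,
        boxDiff (fun z : S → ℝ => g (facePoint S Sᶜ z)) (gridBox N l)) +
        ∑ q ∈ (Finset.univ.filter fun S : Finset ι => S.Nonempty).sigma
          (fun S => (Finset.univ : Finset (S → Fin N))),
          ((-1) ^ q.1.card * boxDiff (fun z : q.1 → ℝ => g (facePoint q.1 q.1ᶜ z))
            (gridBox N q.2)) * orthant (gridCorner e q.1 q.2) x =
        g (fun j => ((gridIndex N (x (e j)) : ℕ) : ℝ) / N) := by
      rw [habel, Finset.sum_sigma]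
      rw [← Finset.sum_filter_not_add_sum_filter Finset.univ (fun S : Finset ι => S.Nonempty)
        (fun S : Finset ι => ∑ l : S → Fin N, _ * _)]
      congr 1
      · refine Finset.sum_congr rfl fun S hS => Finset.sum_congr rfl fun l _ => ?_
        have hS' : S = ∅ := Finset.not_nonempty_iff_eq_empty.mp (Finset.mem_filter.mp hS).2
        subst hS'
        simp
      · refine Finset.sum_congr rfl fun S _ => Finset.sum_congr rfl fun l _ => ?_
        rw [orthant_gridCorner he S l hx, Finset.prod_neg]
        simp only [Finset.card_univ, Fintype.card_coe]
        ring
    rw [hrepr, ← Real.dist_eq]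
    refine (hgδ _ ⟨fun j => (hmem j).1, fun j => (hmem j).2⟩ _
      ⟨fun j => (gridIndex_div_mem _).1, fun j => (gridIndex_div_mem _).2⟩ ?_).le
    refine lt_of_le_of_lt ((dist_pi_le_iff (by positivity)).mpr fun j => ?_) hNδ
    rw [Real.dist_eq]
    exact abs_sub_gridIndex_le (hmem j)

/-- The Koksma–Hlawka inequality for a function of the coordinates `e j`. -/
theorem enorm_dev_le_hkVariation {n : ℕ} {a : Fin n → κ → ℝ} (hn : 0 < n)
    (ha : ∀ i j, a i j ∈ Ico (0 : ℝ) 1) {e : ι → κ} (he : Function.Injective e) {S : Finset κ}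
    (heS : ∀ j, e j ∈ S) {g : (ι → ℝ) → ℝ} (hg : ContinuousOn g (Icc 0 1)) :
    ‖dev a (fun x => g (fun j => x (e j)))‖ₑ ≤ hkVariation g * discrepancyOn a S := by
  refine (orthantApprox_of_continuousOn he heS hg).enorm_dev_le hn ha ?_
  refine ContinuousOn.integrableOn_compact isCompact_Icc ?_
  refine hg.comp (by fun_prop) fun x hx => ⟨fun j => hx.1 (e j), fun j => hx.2 (e j)⟩

end KoksmaHlawka

/-! ### Integration errors of linear and quadratic functions -/

section Quadratic

variable {κ : Type} [Fintype κ]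

/-- A discrete form of `1 - x = ∫₀¹ 1[x ≤ t] dt`, with total weight 1. -/
lemma one_sub_gridIndex {N : ℕ} [NeZero N] (x : ℝ) :
    1 - ((gridIndex N x : ℕ) : ℝ) / N =
      ∑ l : Fin N, (1 / N) * (if x ≤ (l : ℝ) / N then (1 : ℝ) else 0) := by
  have hN : (N : ℝ) ≠ 0 := Nat.cast_ne_zero.mpr (NeZero.ne N)
  have h := abel_one (fun k : Fin (N + 1) => ((k : ℕ) : ℝ) / N) (gridIndex N x)
  simp only [Fin.val_last, div_self hN, gridIndex_le_castSucc, Fin.val_succ,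
    Fin.val_castSucc] at h
  rw [h, sub_add_cancel_right, ← Finset.sum_neg_distrib]
  refine Finset.sum_congr rfl fun l _ => ?_
  push_cast
  ring

lemma orthantApprox_one_sub_mul {S : Finset κ} {j k : κ} (hj : j ∈ S) (hk : k ∈ S) :
    OrthantApprox S 1 (fun x => (1 - x j) * (1 - x k)) := by
  classical
  intro ε hε
  obtain ⟨N, hN0, hNδ⟩ := exists_one_div_lt_neZero (half_pos hε)
  have hN : (0 : ℝ) < N := Nat.cast_pos.mpr (NeZero.pos N)
  have hfrac : ∀ l : Fin N, (0 : ℝ) ≤ (l : ℝ) / N ∧ (l : ℝ) / N ≤ 1 := fun l =>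
    ⟨by positivity, by rw [div_le_one hN]; exact_mod_cast l.isLt.le⟩
  refine ⟨Fin N × Fin N, Finset.univ, 0, fun _ => (1 / N) * (1 / N),
    -- The minimum imposes both constraints at once, which also covers `j = k`.
    fun q i => min (if i = j then (q.1 : ℝ) / N else 1) (if i = k then (q.2 : ℝ) / N else 1),
    ?_, ?_, ?_⟩
  · intro q _
    refine ⟨⟨fun i => ?_, fun i => ?_⟩, fun i hi => ?_⟩
    · have h1 := (hfrac q.1).1
      have h2 := (hfrac q.2).1
      refine le_min ?_ ?_ <;> split_ifs <;> simp [h1, h2]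
    · refine (min_le_left _ _).trans ?_
      split_ifs
      · exact (hfrac q.1).2
      · simp
    · have h1 : i ≠ j := fun h => hi (by rwa [h])
      have h2 : i ≠ k := fun h => hi (by rwa [h])
      simp [h1, h2]
  · have hN' : (N : ℝ≥0∞) ≠ 0 := Nat.cast_ne_zero.mpr (NeZero.ne N)
    have h1 : ‖(1 / (N : ℝ)) * (1 / N)‖ₑ = ENNReal.ofReal (1 / (N * N)) := by
      rw [Real.enorm_eq_ofReal (by positivity)]
      congr 1
      ring
    rw [Finset.sum_const, h1, nsmul_eq_mul, ← ENNReal.ofReal_natCast,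
      ← ENNReal.ofReal_mul (by positivity)]
    simp only [Finset.card_univ, Fintype.card_prod, Fintype.card_fin]
    push_cast
    rw [mul_one_div_cancel (by positivity), ENNReal.ofReal_one]
  · intro x hx
    have horth : ∀ q : Fin N × Fin N,
        orthant (fun i => min (if i = j then (q.1 : ℝ) / N else 1)
          (if i = k then (q.2 : ℝ) / N else 1)) x =
        (if x j ≤ (q.1 : ℝ) / N then (1 : ℝ) else 0) * (if x k ≤ (q.2 : ℝ) / N then 1 else 0) := by
      intro q
      unfold orthant
      rw [indicator_apply, ite_zero_mul_ite_zero, one_mul]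
      refine if_congr ?_ rfl rfl
      rw [mem_Iic, Pi.le_def]
      constructor
      · intro h
        have h1 := (le_min_iff.mp (h j)).1
        have h2 := (le_min_iff.mp (h k)).2
        rw [if_pos rfl] at h1 h2
        exact ⟨h1, h2⟩
      · intro h i
        refine le_min ?_ ?_
        · split_ifs with hi
          · rw [hi]; exact h.1
          · exact hx.2 i
        · split_ifs with hi
          · rw [hi]; exact h.2
          · exact hx.2 i
    have hsum : ∑ q : Fin N × Fin N, (1 / (N : ℝ)) * (1 / N) *
        orthant (fun i => min (if i = j then (q.1 : ℝ) / N else 1)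
          (if i = k then (q.2 : ℝ) / N else 1)) x =
        (1 - ((gridIndex N (x j) : ℕ) : ℝ) / N) * (1 - ((gridIndex N (x k) : ℕ) : ℝ) / N) := by
      rw [one_sub_gridIndex, one_sub_gridIndex, Finset.sum_mul_sum, Fintype.sum_prod_type]
      refine Finset.sum_congr rfl fun l _ => Finset.sum_congr rfl fun m _ => ?_
      rw [horth]
      ring
    rw [hsum, zero_add]
    have hxj : x j ∈ Icc (0 : ℝ) 1 := ⟨hx.1 j, hx.2 j⟩
    have hxk : x k ∈ Icc (0 : ℝ) 1 := ⟨hx.1 k, hx.2 k⟩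
    have h1 := abs_sub_gridIndex_le (N := N) hxj
    have h2 := abs_sub_gridIndex_le (N := N) hxk
    have h3 := gridIndex_div_mem (N := N) (x k)
    set y := ((gridIndex N (x j) : ℕ) : ℝ) / N
    set z := ((gridIndex N (x k) : ℕ) : ℝ) / N
    have h4 : (1 - x j) * (1 - x k) - (1 - y) * (1 - z) =
      -((1 - x j) * (x k - z) + (x j - y) * (1 - z)) := by ring
    rw [h4, abs_neg]
    refine (abs_add_le _ _).trans ?_
    rw [abs_mul, abs_mul]
    have h5 : |1 - x j| ≤ 1 := abs_le.mpr ⟨by linarith [hxj.2], by linarith [hxj.1]⟩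
    have h6 : |1 - z| ≤ 1 := abs_le.mpr ⟨by linarith [h3.2], by linarith [h3.1]⟩
    have h7 := mul_le_mul h5 h2 (abs_nonneg _) zero_le_one
    have h8 := mul_le_mul h1 h6 (abs_nonneg _) (by positivity)
    linarith

lemma orthantApprox_one_sub {S : Finset κ} {j : κ} (hj : j ∈ S) :
    OrthantApprox S 1 (fun x => 1 - x j) := by
  classical
  intro ε hε
  obtain ⟨N, hN0, hNδ⟩ := exists_one_div_lt_neZero hε
  have hN : (0 : ℝ) < N := Nat.cast_pos.mpr (NeZero.pos N)
  refine ⟨Fin N, Finset.univ, 0, fun _ => 1 / N,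
    fun l i => if i = j then (l : ℝ) / N else 1, ?_, ?_, ?_⟩
  · intro l _
    refine ⟨⟨fun i => ?_, fun i => ?_⟩, fun i hi => ?_⟩
    · dsimp only
      split_ifs
      · simp only [Pi.zero_apply]; positivity
      · simp
    · dsimp only
      split_ifs
      · rw [Pi.one_apply, div_le_one hN]; exact_mod_cast l.isLt.le
      · simp
    · have h1 : i ≠ j := fun h => hi (by rwa [h])
      simp [h1]
  · rw [Finset.sum_const, Real.enorm_eq_ofReal (by positivity), nsmul_eq_mul,
      ← ENNReal.ofReal_natCast, ← ENNReal.ofReal_mul (by positivity), Finset.card_univ,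
      Fintype.card_fin, mul_one_div_cancel hN.ne', ENNReal.ofReal_one]
  · intro x hx
    have hsum : ∑ l : Fin N, (1 / (N : ℝ)) *
        orthant (fun i => if i = j then (l : ℝ) / N else 1) x =
        1 - ((gridIndex N (x j) : ℕ) : ℝ) / N := by
      rw [one_sub_gridIndex]
      refine Finset.sum_congr rfl fun l _ => ?_
      congr 1
      unfold orthant
      rw [indicator_apply]
      refine if_congr ?_ rfl rfl
      rw [mem_Iic, Pi.le_def]
      constructor
      · intro h
        simpa using h j
      · intro h i
        split_ifs with hi
        · rw [hi]; exact h
        · exact hx.2 i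
    rw [hsum, zero_add]
    have h1 := abs_sub_gridIndex_le (N := N) (x := x j) ⟨hx.1 j, hx.2 j⟩
    rw [abs_sub_comm] at h1
    have h4 : 1 - x j - (1 - ((gridIndex N (x j) : ℕ) : ℝ) / N) =
      ((gridIndex N (x j) : ℕ) : ℝ) / N - x j := by ring
    rw [h4]
    linarith

variable {n : ℕ} {a : Fin n → κ → ℝ}

lemma integrableOn_cube {G : (κ → ℝ) → ℝ} (hG : ContinuousOn G (Icc 0 1)) :
    IntegrableOn G (Icc 0 1) :=
  hG.integrableOn_compact isCompact_Icc

lemma enorm_dev_coord_le (hn : 0 < n) (ha : ∀ i j, a i j ∈ Ico (0 : ℝ) 1) {S : Finset κ} {j : κ}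
    (hj : j ∈ S) : ‖dev a (fun x => x j - 1 / 2)‖ₑ ≤ discrepancyOn a S := by
  have h := (orthantApprox_one_sub hj).enorm_dev_le hn ha
    (integrableOn_cube (by fun_prop))
  have h2 : dev a (fun x => x j - 1 / 2) = -dev a (fun x => 1 - x j) := by
    have : (fun x : κ → ℝ => x j - 1 / 2) = fun x => 1 / 2 - (1 - x j) := by
      funext x; ring
    rw [this, dev_sub a (integrableOn_const_cube _) (integrableOn_cube (by fun_prop)),
      dev_const a hn]
    ring
  rw [h2, enorm_neg]
  simpa using h

/-- The factor is `2 = 1 + 1/2 + 1/2`: up to a constant, the function is `(1 - x_j)(1 - x_k)` plus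
half of each centred coordinate. -/
lemma enorm_dev_mul_coord_le (hn : 0 < n) (ha : ∀ i j, a i j ∈ Ico (0 : ℝ) 1) {S : Finset κ}
    {j k : κ} (hj : j ∈ S) (hk : k ∈ S) :
    ‖dev a (fun x => (x j - 1 / 2) * (x k - 1 / 2))‖ₑ ≤ 2 * discrepancyOn a S := by
  have h := (orthantApprox_one_sub_mul hj hk).enorm_dev_le hn ha
    (integrableOn_cube (by fun_prop))
  have hj' := enorm_dev_coord_le hn ha hj
  have hk' := enorm_dev_coord_le hn ha hk
  have h2 : dev a (fun x => (x j - 1 / 2) * (x k - 1 / 2)) =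
      dev a (fun x => (1 - x j) * (1 - x k)) + 1 / 2 * dev a (fun x => x j - 1 / 2) +
        1 / 2 * dev a (fun x => x k - 1 / 2) := by
    have : (fun x : κ → ℝ => (x j - 1 / 2) * (x k - 1 / 2)) = fun x =>
        (((1 - x j) * (1 - x k) + 1 / 2 * (x j - 1 / 2)) + 1 / 2 * (x k - 1 / 2)) + (- 1 / 4) := by
      funext x; ring
    rw [this, dev_add a (integrableOn_cube (by fun_prop)) (integrableOn_const_cube _),
      dev_add a (integrableOn_cube (by fun_prop)) (integrableOn_cube (by fun_prop)),
      dev_add a (integrableOn_cube (by fun_prop)) (integrableOn_cube (by fun_prop)),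
      dev_const a hn, dev_const_mul, dev_const_mul]
    ring
  have hhalf : ‖(1 / 2 : ℝ)‖ₑ = 2⁻¹ := by
    rw [Real.enorm_eq_ofReal (by norm_num), one_div, ENNReal.ofReal_inv_of_pos (by norm_num)]
    simp
  rw [h2]
  calc _ ≤ (discrepancyOn a S + 2⁻¹ * discrepancyOn a S) + 2⁻¹ * discrepancyOn a S := by
        refine (enorm_add_le _ _).trans (add_le_add ((enorm_add_le _ _).trans
          (add_le_add ?_ ?_)) ?_)
        · simpa using h
        · rw [enorm_mul, hhalf]; gcongr
        · rw [enorm_mul, hhalf]; gcongr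
    _ = 2 * discrepancyOn a S := by
        rw [add_assoc, ← add_mul, ENNReal.inv_two_add_inv_two, one_mul, two_mul]

end Quadratic

/-! ### Orthogonal affine functions on the cube -/

section Moments

variable {κ : Type} [Fintype κ] [DecidableEq κ]

lemma integral_cube_prod (g : κ → ℝ → ℝ) :
    ∫ x in Icc (0 : κ → ℝ) 1, ∏ i, g i (x i) = ∏ i, ∫ t in Icc (0 : ℝ) 1, g i t := by
  rw [← pi_univ_Icc, volume_pi, Measure.restrict_pi_pi]
  exact integral_fintype_prod_eq_prod (fun i => g i)

lemma integral_unit_sub_half : ∫ t in Icc (0 : ℝ) 1, (t - 1 / 2) = 0 := by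
  rw [integral_Icc_eq_integral_Ioc, ← intervalIntegral.integral_of_le zero_le_one]
  simp

lemma integral_unit_sub_half_sq : ∫ t in Icc (0 : ℝ) 1, (t - 1 / 2) * (t - 1 / 2) = 1 / 12 := by
  rw [integral_Icc_eq_integral_Ioc, ← intervalIntegral.integral_of_le zero_le_one]
  have : ∀ t : ℝ, (t - 1 / 2) * (t - 1 / 2) = t ^ 2 - t + 1 / 4 := fun t => by ring
  simp_rw [this]
  rw [intervalIntegral.integral_add, intervalIntegral.integral_sub]
  · simp
    norm_num
  all_goals exact Continuous.intervalIntegrable (by fun_prop) _ _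

/-- The constant function `1` and the centred coordinates. -/
noncomputable def centred (o : Option κ) (x : κ → ℝ) : ℝ := o.elim 1 (fun j => x j - 1 / 2)

/-- The squared `L²`-norms of the functions `centred o`. -/
noncomputable def centredNormSq (o : Option κ) : ℝ := o.elim 1 (fun _ => 1 / 12)

@[fun_prop]
lemma continuous_centred (o : Option κ) : Continuous (centred o : (κ → ℝ) → ℝ) := by
  cases o with
  | none => exact continuous_const
  | some j => exact (continuous_apply j).sub continuous_const

lemma centredNormSq_pos (o : Option κ) : 0 < centredNormSq o := by
  cases o <;> simp [centredNormSq]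

lemma abs_centred_le_one (o : Option κ) {x : κ → ℝ} (hx : x ∈ Icc (0 : κ → ℝ) 1) :
    |centred o x| ≤ 1 := by
  cases o with
  | none => simp [centred]
  | some j =>
    have h0 := hx.1 j
    have h1 := hx.2 j
    simp only [Pi.zero_apply, Pi.one_apply] at h0 h1
    simp only [centred, Option.elim, abs_le]
    constructor <;> linarith

lemma abs_centred_some_le (j : κ) {x : κ → ℝ} (hx : x ∈ Icc (0 : κ → ℝ) 1) :
    |centred (some j) x| ≤ 1 / 2 := by
  have h0 := hx.1 j
  have h1 := hx.2 j
  simp only [Pi.zero_apply, Pi.one_apply] at h0 h1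
  simp only [centred, Option.elim, abs_le]
  constructor <;> linarith

lemma integral_centred_some (j : κ) : ∫ x in Icc (0 : κ → ℝ) 1, (x j - 1 / 2) = 0 := by
  have h : ∀ x : κ → ℝ, x j - 1 / 2 = ∏ i, (if i = j then x i - 1 / 2 else 1) := by
    intro x
    simp
  simp_rw [h]
  rw [integral_cube_prod (fun i t => if i = j then t - 1 / 2 else 1)]
  refine Finset.prod_eq_zero (Finset.mem_univ j) ?_
  simpa using integral_unit_sub_half

/-- The integrand factors over the coordinates, leaving the mean 0 and variance 1/12 of the centred
uniform law. -/
lemma integral_centred_mul (o o' : Option κ) :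
    ∫ x in Icc (0 : κ → ℝ) 1, centred o x * centred o' x =
      if o = o' then centredNormSq o else 0 := by
  cases o with
  | none =>
    cases o' with
    | none => simp [centred, centredNormSq, Measure.real, volume_cube]
    | some k => simpa [centred] using integral_centred_some k
  | some j =>
    cases o' with
    | none => simpa [centred] using integral_centred_some j
    | some k =>
      simp only [centred, centredNormSq, Option.elim, Option.some.injEq]
      have h : ∀ x : κ → ℝ, (x j - 1 / 2) * (x k - 1 / 2) =
          ∏ i, (if i = j then x i - 1 / 2 else 1) * (if i = k then x i - 1 / 2 else 1) := by
        intro x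
        rw [Finset.prod_mul_distrib]
        simp
      simp_rw [h]
      rw [integral_cube_prod (fun i t => (if i = j then t - 1 / 2 else 1) *
        (if i = k then t - 1 / 2 else 1))]
      split_ifs with hjk
      · subst hjk
        rw [Finset.prod_eq_single j]
        · simpa using integral_unit_sub_half_sq
        · intro i _ hi
          simp [hi, Measure.real]
        · simp
      · refine Finset.prod_eq_zero (Finset.mem_univ j) ?_
        simpa [hjk] using integral_unit_sub_half

end Moments

/-! ### Residual sums of squares in terms of the population coefficients -/

section Projection

variable {κ : Type} [Fintype κ] [DecidableEq κ] {n : ℕ} {a : Fin n → κ → ℝ}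

/-- The affine function with coefficients `c` with respect to `centred`. -/
noncomputable def combo (B : Finset (Option κ)) (c : Option κ → ℝ) (x : κ → ℝ) : ℝ :=
  ∑ o ∈ B, c o * centred o x

@[fun_prop]
lemma continuous_combo (B : Finset (Option κ)) (c : Option κ → ℝ) : Continuous (combo B c) := by
  unfold combo
  fun_prop

/-- The inner product of `f` and `centred o`. -/
noncomputable def innerCentred (f : (κ → ℝ) → ℝ) (o : Option κ) : ℝ :=
  ∫ x in Icc (0 : κ → ℝ) 1, f x * centred o x

/-- The coefficients of the `L²` projection of `f` with respect to `centred`. -/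
noncomputable def projCoeff (f : (κ → ℝ) → ℝ) (o : Option κ) : ℝ :=
  innerCentred f o / centredNormSq o

lemma mean_eq_integral_add_dev (G : (κ → ℝ) → ℝ) :
    (∑ i, G (a i)) / n = (∫ x in Icc (0 : κ → ℝ) 1, G x) + dev a G := by
  unfold dev
  ring

lemma integral_combo_mul (B : Finset (Option κ)) (c : Option κ → ℝ) (o : Option κ) :
    ∫ x in Icc (0 : κ → ℝ) 1, combo B c x * centred o x =
      if o ∈ B then c o * centredNormSq o else 0 := by
  unfold combo
  simp_rw [Finset.sum_mul, mul_assoc]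
  rw [integral_finsetSum _ (fun o' _ => integrableOn_cube (by fun_prop))]
  simp_rw [integral_const_mul, integral_centred_mul]
  rw [← Finset.sum_ite_eq' B o (fun o => c o * centredNormSq o)]
  refine Finset.sum_congr rfl fun o' _ => ?_
  split_ifs with h
  · rw [h]
  · simp

/-- By orthogonality, subtracting the projection removes the components in `B` and leaves the others
untouched. -/
lemma innerCentred_sub_combo {f : (κ → ℝ) → ℝ} (hf : ContinuousOn f (Icc 0 1))
    (B : Finset (Option κ)) (o : Option κ) :
    innerCentred (fun x => f x - combo B (projCoeff f) x) o =
      if o ∈ B then 0 else innerCentred f o := by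
  unfold innerCentred
  simp_rw [sub_mul]
  rw [integral_sub (integrableOn_cube (by fun_prop)) (integrableOn_cube (by fun_prop)),
    integral_combo_mul]
  split_ifs
  · rw [projCoeff, div_mul_cancel₀ _ (centredNormSq_pos o).ne']
    unfold innerCentred
    ring
  · ring

lemma abs_dev_combo_mul_le {d : ℝ}
    (hd : ∀ o o' : Option κ, |dev a (fun x => centred o x * centred o' x)| ≤ 2 * d)
    (B : Finset (Option κ)) (c : Option κ → ℝ) (o : Option κ) :
    |dev a (fun x => combo B c x * centred o x)| ≤ 2 * d * ∑ o' ∈ B, |c o'| := by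
  unfold combo
  simp_rw [Finset.sum_mul, mul_assoc]
  rw [dev_sum a _ (fun o' _ => integrableOn_cube (by fun_prop)), ← mul_assoc, Finset.mul_sum]
  refine (Finset.abs_sum_le_sum_abs _ _).trans (Finset.sum_le_sum fun o' _ => ?_)
  rw [dev_const_mul, abs_mul]
  nlinarith [hd o' o, abs_nonneg (c o')]

/-- Weighted Cauchy–Schwarz. It converts the `ℓ¹` norm produced by entrywise error bounds into the
population `L²` norm. -/
lemma sum_abs_sq_le (B : Finset (Option κ)) (c : Option κ → ℝ) :
    (∑ o ∈ B, |c o|) ^ 2 ≤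
      (∑ o ∈ B, (centredNormSq o)⁻¹) * ∑ o ∈ B, centredNormSq o * c o ^ 2 := by
  refine Finset.sum_sq_le_sum_mul_sum_of_sq_le_mul B (fun o _ => ?_) (fun o _ => ?_)
    (fun o _ => ?_)
  · exact (inv_pos.mpr (centredNormSq_pos o)).le
  · exact mul_nonneg (centredNormSq_pos o).le (sq_nonneg _)
  · rw [sq_abs, inv_mul_cancel_left₀ (centredNormSq_pos o).ne']

/-- The empirical Gram matrix is close to the population one. -/
lemma le_mean_combo_sq {d : ℝ} (hd0 : 0 ≤ d)
    (hd : ∀ o o' : Option κ, |dev a (fun x => centred o x * centred o' x)| ≤ 2 * d)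
    {B : Finset (Option κ)} (hB : 2 * d * ∑ o ∈ B, (centredNormSq o)⁻¹ ≤ 2 / 9)
    (c : Option κ → ℝ) :
    7 / 9 * ∑ o ∈ B, centredNormSq o * c o ^ 2 ≤ (∑ i, combo B c (a i) ^ 2) / n := by
  have hexp : ∀ x, combo B c x ^ 2 = ∑ o ∈ B, c o * (combo B c x * centred o x) := by
    intro x
    rw [sq]
    nth_rewrite 2 [combo]
    rw [Finset.mul_sum]
    exact Finset.sum_congr rfl fun o _ => by ring
  rw [mean_eq_integral_add_dev (fun x => combo B c x ^ 2)]
  simp_rw [hexp]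
  rw [dev_sum a _ (fun o _ => integrableOn_cube (by fun_prop)),
    integral_finsetSum _ (fun o _ => integrableOn_cube (by fun_prop))]
  simp_rw [dev_const_mul, integral_const_mul, integral_combo_mul]
  have h1 : ∑ o ∈ B, c o * (if o ∈ B then c o * centredNormSq o else 0) =
      ∑ o ∈ B, centredNormSq o * c o ^ 2 := by
    refine Finset.sum_congr rfl fun o ho => ?_
    rw [if_pos ho]
    ring
  -- The error of the quadratic form is controlled by the squared `ℓ¹` norm; Cauchy–Schwarz and `hB`
  -- then limit the loss to 2/9 of the population form.
  have h2 : |∑ o ∈ B, c o * dev a (fun x => combo B c x * centred o x)| ≤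
      2 * d * (∑ o ∈ B, |c o|) ^ 2 := by
    rw [sq, ← mul_assoc, Finset.mul_sum]
    refine (Finset.abs_sum_le_sum_abs _ _).trans (Finset.sum_le_sum fun o _ => ?_)
    rw [abs_mul, mul_comm]
    exact mul_le_mul_of_nonneg_right (abs_dev_combo_mul_le hd B c o) (abs_nonneg _)
  have h3 := sum_abs_sq_le B c
  have h4 : 0 ≤ ∑ o ∈ B, centredNormSq o * c o ^ 2 :=
    Finset.sum_nonneg fun o _ => mul_nonneg (centredNormSq_pos o).le (sq_nonneg _)
  have h5 := mul_le_mul_of_nonneg_left h3 (by positivity : 0 ≤ 2 * d)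
  have h6 := mul_le_mul_of_nonneg_right hB h4
  have h7 := (abs_le.mp h2).1
  rw [h1]
  linarith

/-- The mean squared error of any fit is not much smaller than that of the `L²` projection. -/
lemma mean_sq_sub_proj_le {f : (κ → ℝ) → ℝ} (hf : ContinuousOn f (Icc 0 1)) {d ε : ℝ} (hd0 : 0 ≤ d)
    (hd : ∀ o o' : Option κ, |dev a (fun x => centred o x * centred o' x)| ≤ 2 * d)
    {B : Finset (Option κ)} (hB : 2 * d * ∑ o ∈ B, (centredNormSq o)⁻¹ ≤ 2 / 9)
    (hε : ∀ o, |dev a (fun x => (f x - combo B (projCoeff f) x) * centred o x)| ≤ ε)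
    (c : Option κ → ℝ) :
    (∑ i, (f (a i) - combo B (projCoeff f) (a i)) ^ 2) / n -
      9 / 7 * ε ^ 2 * ∑ o ∈ B, (centredNormSq o)⁻¹ ≤
        (∑ i, (f (a i) - combo B c (a i)) ^ 2) / n := by
  set b := projCoeff f
  set h : Option κ → ℝ := fun o => c o - b o
  have hcombo : ∀ x, combo B c x = combo B b x + combo B h x := by
    intro x
    unfold combo
    rw [← Finset.sum_add_distrib]
    refine Finset.sum_congr rfl fun o _ => ?_
    simp only [h]
    ring
  have hgram := le_mean_combo_sq hd0 hd hB h
  have hexp : (∑ i, (f (a i) - combo B c (a i)) ^ 2) / n =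
      (∑ i, (f (a i) - combo B b (a i)) ^ 2) / n -
        2 * ((∑ i, (f (a i) - combo B b (a i)) * combo B h (a i)) / n) +
        (∑ i, combo B h (a i) ^ 2) / n := by
    rw [mul_div_assoc', ← sub_div, ← add_div, Finset.mul_sum, ← Finset.sum_sub_distrib,
      ← Finset.sum_add_distrib]
    congr 1
    refine Finset.sum_congr rfl fun i _ => ?_
    rw [hcombo]
    ring
  -- The population part of the cross term vanishes because the residual is orthogonal to the
  -- coordinates in `B`.
  have hcross : (∑ i, (f (a i) - combo B b (a i)) * combo B h (a i)) / n =
      ∑ o ∈ B, h o * dev a (fun x => (f x - combo B b x) * centred o x) := by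
    have h1 : ∀ x, (f x - combo B b x) * combo B h x =
        ∑ o ∈ B, h o * ((f x - combo B b x) * centred o x) := by
      intro x
      conv_lhs => rw [combo.eq_def B h, Finset.mul_sum]
      exact Finset.sum_congr rfl fun o _ => by ring
    rw [mean_eq_integral_add_dev (fun x => (f x - combo B b x) * combo B h x)]
    simp_rw [h1]
    rw [dev_sum a _ (fun o _ => integrableOn_cube (by fun_prop)),
      integral_finsetSum _ (fun o _ => integrableOn_cube (by fun_prop))]
    simp_rw [dev_const_mul, integral_const_mul]
    have h2 : ∀ o ∈ B, ∫ x in Icc (0 : κ → ℝ) 1, (f x - combo B b x) * centred o x = 0 := by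
      intro o ho
      have := innerCentred_sub_combo hf B o
      rwa [if_pos ho] at this
    rw [Finset.sum_eq_zero (fun o ho => by rw [h2 o ho, mul_zero]), zero_add]
  -- Young's inequality coordinate by coordinate, with weight 7/9 so that the quadratic part is
  -- absorbed by `hgram`; hence the reciprocal 9/7.
  have hbound : 2 * ∑ o ∈ B, h o * dev a (fun x => (f x - combo B b x) * centred o x) ≤
      7 / 9 * (∑ o ∈ B, centredNormSq o * h o ^ 2) +
        9 / 7 * ε ^ 2 * ∑ o ∈ B, (centredNormSq o)⁻¹ := by
    rw [Finset.mul_sum, Finset.mul_sum, Finset.mul_sum, ← Finset.sum_add_distrib]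
    refine Finset.sum_le_sum fun o _ => ?_
    set δ := dev a (fun x => (f x - combo B b x) * centred o x)
    have hw := centredNormSq_pos o
    have hδ : δ ^ 2 ≤ ε ^ 2 := sq_le_sq' (by linarith [(abs_le.mp (hε o)).1]) (abs_le.mp (hε o)).2
    have h1 : 0 ≤ 7 / 9 * (centredNormSq o)⁻¹ * (centredNormSq o * h o - 9 / 7 * δ) ^ 2 := by
      positivity
    have h2 : 7 / 9 * (centredNormSq o)⁻¹ * (centredNormSq o * h o - 9 / 7 * δ) ^ 2 =
        7 / 9 * (centredNormSq o * h o ^ 2) - 2 * (h o * δ) +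
          9 / 7 * δ ^ 2 * (centredNormSq o)⁻¹ := by
      field_simp
      ring
    have h3 : 9 / 7 * δ ^ 2 * (centredNormSq o)⁻¹ ≤ 9 / 7 * ε ^ 2 * (centredNormSq o)⁻¹ := by
      gcongr
    linarith
  rw [hexp, hcross]
  linarith

/-- Comparison of the mean squared errors of two `L²` projections. -/
lemma le_mean_sq_sub_proj_sub {f : (κ → ℝ) → ℝ} (hf : ContinuousOn f (Icc 0 1)) {ε : ℝ}
    {B₀ B₁ : Finset (Option κ)}
    (hε₀ : ∀ o, |dev a (fun x => (f x - combo B₀ (projCoeff f) x) * centred o x)| ≤ ε)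
    (hε₁ : ∀ o, |dev a (fun x => (f x - combo B₁ (projCoeff f) x) * centred o x)| ≤ ε) :
    (∑ o ∈ B₀ \ B₁, (innerCentred f o ^ 2 / centredNormSq o - 2 * ε * |projCoeff f o|)) -
      ∑ o ∈ B₁ \ B₀, (innerCentred f o ^ 2 / centredNormSq o + 2 * ε * |projCoeff f o|) ≤
    (∑ i, (f (a i) - combo B₁ (projCoeff f) (a i)) ^ 2) / n -
      (∑ i, (f (a i) - combo B₀ (projCoeff f) (a i)) ^ 2) / n := by
  set b := projCoeff f
  -- The difference of squares factors as the sum of the residuals times the difference of the fits.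
  -- Common coordinates cancel in the latter, both projections having the same coefficients there.
  set F : (κ → ℝ) → ℝ := fun x => (f x - combo B₁ b x) + (f x - combo B₀ b x) with hF
  have hFc : ContinuousOn F (Icc 0 1) := by
    simp only [hF]
    fun_prop
  have hdiff : ∀ x, combo B₀ b x - combo B₁ b x = combo (B₀ \ B₁) b x - combo (B₁ \ B₀) b x := by
    intro x
    unfold combo
    exact (Finset.sum_sdiff_sub_sum_sdiff (f := fun o => b o * centred o x)).symm
  have hmean : (∑ i, (f (a i) - combo B₁ b (a i)) ^ 2) / n -
      (∑ i, (f (a i) - combo B₀ b (a i)) ^ 2) / n =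
      (∑ i, F (a i) * combo (B₀ \ B₁) b (a i)) / n -
        (∑ i, F (a i) * combo (B₁ \ B₀) b (a i)) / n := by
    rw [← sub_div, ← sub_div, ← Finset.sum_sub_distrib, ← Finset.sum_sub_distrib]
    congr 1
    refine Finset.sum_congr rfl fun i _ => ?_
    rw [← mul_sub, ← hdiff]
    simp only [hF]
    ring
  have hterm : ∀ B : Finset (Option κ), (∑ i, F (a i) * combo B b (a i)) / n =
      ∑ o ∈ B, b o * (innerCentred F o + dev a (fun x => F x * centred o x)) := by
    intro B
    have h1 : ∀ x, F x * combo B b x = ∑ o ∈ B, b o * (F x * centred o x) := by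
      intro x
      unfold combo
      rw [Finset.mul_sum]
      exact Finset.sum_congr rfl fun o _ => by ring
    simp_rw [h1]
    rw [Finset.sum_comm, Finset.sum_div]
    refine Finset.sum_congr rfl fun o _ => ?_
    rw [← Finset.mul_sum, mul_div_assoc, mean_eq_integral_add_dev (fun x => F x * centred o x)]
    rfl
  have hinner : ∀ o, innerCentred F o = (if o ∈ B₁ then 0 else innerCentred f o) +
      (if o ∈ B₀ then 0 else innerCentred f o) := by
    intro o
    rw [← innerCentred_sub_combo hf B₁ o, ← innerCentred_sub_combo hf B₀ o]
    unfold innerCentred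
    rw [← integral_add (integrableOn_cube (by fun_prop)) (integrableOn_cube (by fun_prop))]
    simp only [hF, add_mul]
    rfl
  have hdev : ∀ o, |b o * dev a (fun x => F x * centred o x)| ≤ 2 * ε * |b o| := by
    intro o
    have h1 : dev a (fun x => F x * centred o x) =
        dev a (fun x => (f x - combo B₁ b x) * centred o x) +
          dev a (fun x => (f x - combo B₀ b x) * centred o x) := by
      rw [← dev_add a (integrableOn_cube (by fun_prop)) (integrableOn_cube (by fun_prop))]
      simp only [hF, add_mul]
    rw [abs_mul, mul_comm, h1]
    refine mul_le_mul_of_nonneg_right ?_ (abs_nonneg _)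
    refine (abs_add_le _ _).trans ?_
    linarith [hε₀ o, hε₁ o]
  have hb : ∀ o, b o * innerCentred f o = innerCentred f o ^ 2 / centredNormSq o := by
    intro o
    simp only [b, projCoeff]
    ring
  rw [hmean, hterm, hterm]
  refine sub_le_sub (Finset.sum_le_sum fun o ho => ?_) (Finset.sum_le_sum fun o ho => ?_)
  · rw [Finset.mem_sdiff] at ho
    rw [hinner, if_neg ho.2, if_pos ho.1, add_zero, mul_add, hb]
    linarith [(abs_le.mp (hdev o)).1]
  · rw [Finset.mem_sdiff] at ho
    rw [hinner, if_neg ho.2, if_pos ho.1, zero_add, mul_add, hb]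
    linarith [(abs_le.mp (hdev o)).2]

end Projection

/-! ### Least squares -/

section LeastSquares

variable {n p : ℕ}

/-- Coefficients indexed by `Option A` as coefficients of an affine function, padded by `0`. -/
noncomputable def padCoeff (A : Finset (Fin p)) (γ : Option A → ℝ) : ℝ × (Fin p → ℝ) :=
  (γ none, fun j => if h : j ∈ A then γ (some ⟨j, h⟩) else 0)

lemma affine_padCoeff (X : Matrix (Fin n) (Fin p) ℝ) (A : Finset (Fin p)) (γ : Option A → ℝ)
    (i : Fin n) : affine (padCoeff A γ) (X i) = (augDesign X A).mulVec γ i := by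
  unfold affine padCoeff augDesign Matrix.mulVec dotProduct
  rw [Fintype.sum_option]
  simp only [Matrix.of_apply, Option.elim, one_mul]
  congr 1
  rw [← Finset.sum_subset (Finset.subset_univ A) (fun j _ hj => by simp [hj]),
    ← Finset.sum_coe_sort A]
  refine Finset.sum_congr rfl fun j _ => ?_
  simp [mul_comm]

lemma padCoeff_restrict {A : Finset (Fin p)} {b : ℝ × (Fin p → ℝ)} (hb : ∀ j ∉ A, b.2 j = 0) :
    padCoeff A (fun o => o.elim b.1 (fun j => b.2 j)) = b := by
  unfold padCoeff
  refine Prod.ext rfl (funext fun j => ?_)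
  dsimp only
  split_ifs with hj
  · rfl
  · exact (hb j hj).symm

/-- The least squares estimator minimizes the residual sum of squares. -/
lemma rss_le_sum_sq {X : Matrix (Fin n) (Fin p) ℝ} {A : Finset (Fin p)}
    (hX : IsUnit ((augDesign X A).transpose * augDesign X A).det) (y : Fin n → ℝ)
    {b : ℝ × (Fin p → ℝ)} (hb : ∀ j ∉ A, b.2 j = 0) :
    rss X y A ≤ ∑ i, (y i - affine b (X i)) ^ 2 := by
  set W := augDesign X A
  set γ : Option A → ℝ := fun o => o.elim b.1 (fun j => b.2 j)
  set γ' := lsEstimator X y A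
  have hnormal : (W.transpose * W).mulVec γ' = W.transpose.mulVec y := by
    simp only [γ', lsEstimator]
    rw [Matrix.mulVec_mulVec, Matrix.mul_nonsing_inv _ hX, Matrix.one_mulVec]
  have hls : ∀ i, affine (lsCoeff X y A) (X i) = W.mulVec γ' i :=
    fun i => affine_padCoeff X A γ' i
  have hb' : ∀ i, affine b (X i) = W.mulVec γ i := by
    intro i
    rw [← affine_padCoeff X A γ i, padCoeff_restrict hb]
  -- By the normal equations the residual is orthogonal to the column space, so the competitor's sum
  -- of squares splits by Pythagoras.
  have horth : ∑ i, (y i - W.mulVec γ' i) * W.mulVec (γ' - γ) i = 0 := by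
    have h1 : ∑ i, (y i - W.mulVec γ' i) * W.mulVec (γ' - γ) i =
        (y - W.mulVec γ') ⬝ᵥ W.mulVec (γ' - γ) := rfl
    rw [h1, Matrix.dotProduct_mulVec, ← Matrix.mulVec_transpose, Matrix.mulVec_sub,
      Matrix.mulVec_mulVec, hnormal, sub_self, zero_dotProduct]
  unfold rss
  simp_rw [hls, hb']
  have hexp : ∑ i, (y i - W.mulVec γ i) ^ 2 = ∑ i, (y i - W.mulVec γ' i) ^ 2 +
      2 * (∑ i, (y i - W.mulVec γ' i) * W.mulVec (γ' - γ) i) +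
        ∑ i, (W.mulVec (γ' - γ) i) ^ 2 := by
    rw [Finset.mul_sum, ← Finset.sum_add_distrib, ← Finset.sum_add_distrib]
    refine Finset.sum_congr rfl fun i _ => ?_
    rw [Matrix.mulVec_sub, Pi.sub_apply]
    ring
  rw [hexp, horth]
  have : 0 ≤ ∑ i, (W.mulVec (γ' - γ) i) ^ 2 := Finset.sum_nonneg fun i _ => sq_nonneg _
  linarith

/-- The coefficients of an affine function with respect to `centred`. -/
noncomputable def toCentred (b : ℝ × (Fin p → ℝ)) (o : Option (Fin p)) : ℝ :=
  o.elim (b.1 + ∑ j, b.2 j * (1 / 2)) b.2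

lemma affine_eq_combo {A : Finset (Fin p)} {b : ℝ × (Fin p → ℝ)} (hb : ∀ j ∉ A, b.2 j = 0)
    (x : Fin p → ℝ) : affine b x = combo (Finset.insertNone A) (toCentred b) x := by
  unfold affine combo
  rw [Finset.sum_insertNone]
  simp only [toCentred, centred, Option.elim, mul_one]
  rw [Finset.sum_subset (Finset.subset_univ A) (fun j _ hj => by rw [hb j hj, zero_mul]),
    add_assoc, ← Finset.sum_add_distrib]
  congr 1
  exact Finset.sum_congr rfl fun j _ => by ring

/-- The affine function of the variables in `A` with given coefficients with respect to
`centred`. -/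
noncomputable def ofCentred (A : Finset (Fin p)) (c : Option (Fin p) → ℝ) : ℝ × (Fin p → ℝ) :=
  (c none - ∑ j ∈ A, c (some j) * (1 / 2), fun j => if j ∈ A then c (some j) else 0)

lemma affine_ofCentred (A : Finset (Fin p)) (c : Option (Fin p) → ℝ) (x : Fin p → ℝ) :
    affine (ofCentred A c) x = combo (Finset.insertNone A) c x := by
  unfold affine combo
  rw [Finset.sum_insertNone]
  simp only [ofCentred, centred, Option.elim, mul_one, ite_mul, zero_mul, Finset.sum_ite_mem,
    Finset.univ_inter, mul_sub, Finset.sum_sub_distrib]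
  ring

lemma lsCoeff_eq_zero {X : Matrix (Fin n) (Fin p) ℝ} {y : Fin n → ℝ} {A : Finset (Fin p)} :
    ∀ j ∉ A, (lsCoeff X y A).2 j = 0 := fun j hj => by simp [lsCoeff, hj]

/-- A kernel vector of `W'W` gives an affine function vanishing at every design site; coercivity
forces its centred coefficients to be zero. The slopes are cleared before the intercept, since
centring mixes them into it. -/
lemma isUnit_det_gram {X : Matrix (Fin n) (Fin p) ℝ} {A : Finset (Fin p)}
    (h : ∀ c : Option (Fin p) → ℝ, 7 / 9 * ∑ o ∈ Finset.insertNone A, centredNormSq o * c o ^ 2 ≤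
      (∑ i, combo (Finset.insertNone A) c (X i) ^ 2) / n) :
    IsUnit ((augDesign X A).transpose * augDesign X A).det := by
  rw [← Matrix.isUnit_iff_isUnit_det, ← Matrix.mulVec_injective_iff_isUnit]
  refine (injective_iff_map_eq_zero
    (Matrix.mulVecLin ((augDesign X A).transpose * augDesign X A))).mpr fun γ hγ => ?_
  have hγ' : (augDesign X A).mulVec γ = 0 := by
    have := (LinearMap.mem_ker (f := Matrix.mulVecLin _)).mpr hγ
    rw [Matrix.ker_mulVecLin_transpose_mul_self] at this
    exact this
  have hpad : ∀ j ∉ A, (padCoeff A γ).2 j = 0 := fun j hj => by simp [padCoeff, hj]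
  have hzero : ∀ i, combo (Finset.insertNone A) (toCentred (padCoeff A γ)) (X i) = 0 := by
    intro i
    rw [← affine_eq_combo hpad, affine_padCoeff, hγ']
    rfl
  have hsum := h (toCentred (padCoeff A γ))
  simp only [hzero, ne_eq, OfNat.ofNat_ne_zero, not_false_eq_true, zero_pow,
    Finset.sum_const_zero, zero_div] at hsum
  have hall := (Finset.sum_eq_zero_iff_of_nonneg (fun o _ =>
    mul_nonneg (centredNormSq_pos o).le (sq_nonneg (toCentred (padCoeff A γ) o)))).mp
    (le_antisymm (by linarith) (Finset.sum_nonneg fun o _ =>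
      mul_nonneg (centredNormSq_pos o).le (sq_nonneg (toCentred (padCoeff A γ) o))))
  have hc : ∀ o ∈ Finset.insertNone A, toCentred (padCoeff A γ) o = 0 := by
    intro o ho
    have := hall o ho
    simpa [(centredNormSq_pos o).ne'] using this
  have hsome : ∀ j : A, γ (some j) = 0 := by
    intro j
    have := hc (some (j : Fin p)) (by simp)
    simpa [toCentred, padCoeff] using this
  have hpad0 : (padCoeff A γ).2 = 0 := by
    funext j
    simp only [padCoeff]
    split_ifs with hj
    · exact hsome ⟨j, hj⟩
    · rfl
  funext o
  cases o with
  | some j => exact hsome j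
  | none =>
    have := hc none (by simp)
    have h1 : (padCoeff A γ).1 = 0 := by simpa [toCentred, hpad0] using this
    exact h1

end LeastSquares

/-! ### Reflection of a coordinate -/

section Reflection

variable {κ : Type} [Fintype κ] [DecidableEq κ]

/-- A function that does not depend on `x j` is orthogonal to the centred coordinate `j`. -/
lemma innerCentred_eq_zero_of_forall_eq {f : (κ → ℝ) → ℝ} {j : κ}
    (hf : ∀ x y : κ → ℝ, (∀ i, i ≠ j → x i = y i) → f x = f y) :
    innerCentred f (some j) = 0 := by
  -- The reflection `x_j ↦ 1 - x_j` preserves the cube and the measure, fixes `f` and changes the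
  -- sign of `x_j - 1/2`.
  set T : (κ → ℝ) → κ → ℝ := fun x i => if i = j then 1 - x i else x i with hT
  have hinv : Function.Involutive T := by
    intro x
    funext i
    simp only [hT]
    split_ifs <;> ring
  have hpres : MeasurePreserving T := by
    refine volume_preserving_pi (f := fun i t => if i = j then 1 - t else t) fun i => ?_
    by_cases hi : i = j
    · simpa [hi] using Measure.measurePreserving_sub_left volume (1 : ℝ)
    · simp only [hi, if_false]
      exact MeasurePreserving.id volume
  have hemb : MeasurableEmbedding T :=
    (MeasurableEquiv.ofInvolutive T hinv hpres.measurable).measurableEmbedding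
  have hpre : T ⁻¹' Icc 0 1 = Icc 0 1 := by
    ext x
    simp only [mem_preimage, mem_Icc, Pi.le_def, ← forall_and, hT, Pi.zero_apply, Pi.one_apply]
    refine forall_congr' fun i => ?_
    split_ifs
    · constructor <;> rintro ⟨h1, h2⟩ <;> constructor <;> linarith
    · rfl
  have h := hpres.setIntegral_preimage_emb hemb (fun x => f x * centred (some j) x) (Icc 0 1)
  have hanti : ∀ x, f (T x) * centred (some j) (T x) = -(f x * centred (some j) x) := by
    intro x
    rw [hf (T x) x (fun i hi => by simp [hT, hi])]
    simp only [centred, Option.elim, hT, if_pos]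
    ring
  rw [hpre] at h
  simp_rw [hanti] at h
  rw [integral_neg] at h
  unfold innerCentred
  linarith

lemma abs_innerCentred_some_le {f : (κ → ℝ) → ℝ} {c : ℝ}
    (h : ∀ x ∈ Icc (0 : κ → ℝ) 1, |f x| ≤ c) (j : κ) : |innerCentred f (some j)| ≤ c / 2 := by
  refine abs_integral_cube_le fun x hx => ?_
  rw [abs_mul, div_eq_mul_one_div]
  exact mul_le_mul (h x hx) (abs_centred_some_le j hx) (abs_nonneg _)
    ((abs_nonneg _).trans (h x hx))

lemma abs_projCoeff_le {f : (κ → ℝ) → ℝ} {c : ℝ}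
    (h : ∀ x ∈ Icc (0 : κ → ℝ) 1, |f x| ≤ c) (o : Option κ) : |projCoeff f o| ≤ 6 * c := by
  have hc : 0 ≤ c := (abs_nonneg _).trans (h 0 ⟨le_rfl, zero_le_one⟩)
  unfold projCoeff
  rw [abs_div, abs_of_pos (centredNormSq_pos o), div_le_iff₀ (centredNormSq_pos o)]
  cases o with
  | none =>
    have h1 : |innerCentred f none| ≤ c := by
      refine abs_integral_cube_le fun x hx => ?_
      simpa [centred] using h x hx
    simp only [centredNormSq, Option.elim]
    linarith
  | some j =>
    have := abs_innerCentred_some_le h j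
    simp only [centredNormSq, Option.elim]
    linarith

lemma abs_le_toReal_cubeSup {g : (κ → ℝ) → ℝ} (hg : cubeSup g ≠ ⊤) {x : κ → ℝ}
    (hx : x ∈ Icc (0 : κ → ℝ) 1) : |g x| ≤ (cubeSup g).toReal := by
  have h : ‖g x‖ₑ ≤ cubeSup g :=
    le_iSup₂ (f := fun (x : κ → ℝ) (_ : x ∈ Icc (0 : κ → ℝ) 1) => ‖g x‖ₑ) x hx
  rwa [Real.enorm_eq_ofReal_abs, ENNReal.ofReal_le_iff_le_toReal hg] at h

lemma cubeSup_ne_top {g : (κ → ℝ) → ℝ} (hg : ContinuousOn g (Icc 0 1)) : cubeSup g ≠ ⊤ := by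
  obtain ⟨c, hc⟩ := isCompact_Icc.exists_bound_of_continuousOn hg
  refine ne_top_of_le_ne_top (b := ENNReal.ofReal c) ENNReal.ofReal_ne_top ?_
  refine iSup₂_le fun x hx => ?_
  rw [← ofReal_norm]
  exact ENNReal.ofReal_le_ofReal (hc x hx)

end Reflection

/-- The support condition holds for a minimizer and for the default value `0` alike, and the
estimates below rely on nothing else about `bla`. -/
lemma bla_eq_zero {p : ℕ} (f : (Fin p → ℝ) → ℝ) (A : Finset (Fin p)) :
    ∀ j ∉ A, (bla f A).2 j = 0 := by
  intro j hj
  unfold bla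
  split_ifs with h
  · exact h.choose_spec.1 j hj
  · rfl

namespace Experiment

variable {n : ℕ} (E : Experiment n)

lemma fT_congr {x y : Fin E.p → ℝ} (h : ∀ j ∈ E.A₀, x j = y j) : E.fT x = E.fT y := by
  unfold fT
  congr 1
  funext j
  exact h _ (by simp [A₀])

variable {E} {τ : ℝ}

lemma NearlySparse.continuousOn_fT (hs : E.NearlySparse τ) : ContinuousOn E.fT (Icc 0 1) :=
  hs.fTilde_continuous.comp (by fun_prop) fun x hx => ⟨fun j => hx.1 _, fun j => hx.2 _⟩

lemma NearlySparse.abs_sub_le (hs : E.NearlySparse τ) {x : Fin E.p → ℝ} (hx : x ∈ Icc 0 1) :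
    |E.f x - E.fT x| ≤ E.η :=
  (abs_le_toReal_cubeSup hs.approx.ne_top hx).trans
    (ENNReal.toReal_le_of_le_ofReal hs.η_pos.le hs.approx.le)

lemma lt_abs_innerCentred (hs : E.NearlySparse τ) {j : Fin E.p} (hj : j ∈ E.A₀) :
    τ < |innerCentred E.f (some j)| := by
  have h := hs.signal j hj
  have hf := E.f_continuous
  have h1 : innerCentred E.f (some j) =
      (∫ x in Icc (0 : Fin E.p → ℝ) 1, x j * E.f x) -
        1 / 2 * ∫ x in Icc (0 : Fin E.p → ℝ) 1, E.f x := by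
    rw [← integral_const_mul, ← integral_sub (integrableOn_cube (by fun_prop))
      (integrableOn_cube (by fun_prop))]
    unfold innerCentred
    congr 1
    funext x
    simp only [centred, Option.elim]
    ring
  rwa [h1]

/-- Inactive inputs have small coefficients. -/
lemma abs_innerCentred_le_of_notMem (hs : E.NearlySparse τ) {j : Fin E.p} (hj : j ∉ E.A₀) :
    |innerCentred E.f (some j)| ≤ E.η / 2 := by
  have hf := E.f_continuous
  have hfT := hs.continuousOn_fT
  have h0 : innerCentred E.fT (some j) = 0 :=
    innerCentred_eq_zero_of_forall_eq fun x y hxy =>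
      E.fT_congr fun i hi => hxy i fun hij => hj (hij ▸ hi)
  have h1 : innerCentred E.f (some j) = innerCentred (fun x => E.f x - E.fT x) (some j) := by
    rw [← sub_zero (innerCentred E.f (some j)), ← h0]
    unfold innerCentred
    rw [← integral_sub (integrableOn_cube (by fun_prop)) (integrableOn_cube (by fun_prop))]
    simp only [sub_mul]
  rw [h1]
  exact abs_innerCentred_some_le (fun x hx => hs.abs_sub_le hx) j

/-- The coefficients of the inputs outside `A` are controlled by the residual function of `A`. -/
lemma abs_innerCentred_le_blaResidual (hs : E.NearlySparse τ) {A : Finset (Fin E.p)}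
    {j : Fin E.p} (hj : j ∉ A) {c : ℝ}
    (hc : ∀ x ∈ Icc (0 : Fin E.p → ℝ) 1, |E.blaResidual A x| ≤ c) :
    |innerCentred E.f (some j)| ≤ (c + E.η) / 2 := by
  have hf := E.f_continuous
  -- Subtracting an affine function of the variables in `A` does not change the inner product with a
  -- centred coordinate outside `A`.
  have h1 : innerCentred E.f (some j) =
      innerCentred (fun x => E.f x - affine (bla E.f A) x) (some j) := by
    simp_rw [affine_eq_combo (bla_eq_zero E.f A)]
    have h0 := integral_combo_mul (Finset.insertNone A) (toCentred (bla E.f A)) (some j)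
    rw [if_neg (by simpa using hj)] at h0
    rw [← sub_zero (innerCentred E.f (some j)), ← h0]
    unfold innerCentred
    rw [← integral_sub (integrableOn_cube (by fun_prop)) (integrableOn_cube (by fun_prop))]
    simp only [sub_mul]
  rw [h1]
  refine abs_innerCentred_some_le (fun x hx => ?_) j
  have h2 : E.f x - affine (bla E.f A) x = E.blaResidual A x + (E.f x - E.fT x) := by
    unfold blaResidual
    ring
  rw [h2]
  exact (abs_add_le _ _).trans (add_le_add (hc x hx) (hs.abs_sub_le hx))

/-! ### Integration errors in the screening problem -/

lemma exists_mem_U₃ (j : Fin E.p) : ∃ S ∈ E.U₃, insert j E.A₀ ⊆ S := by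
  by_cases hj : j ∈ E.A₀
  -- An active `j` adds nothing to `A₀`, so an inactive input is adjoined; the one with zero-based
  -- index `p₀` exists because `p₀ < p`.
  · refine ⟨E.A₀ ∪ {⟨E.p₀, E.p₀_lt_p⟩}, ?_, ?_⟩
    · simp only [U₃, Finset.mem_filter, Finset.mem_univ, true_and]
      exact ⟨_, by simp [A₀], by simp, rfl⟩
    · rw [Finset.insert_eq_of_mem hj]
      exact Finset.subset_union_left
  · refine ⟨E.A₀ ∪ {j}, ?_, ?_⟩
    · simp only [U₃, Finset.mem_filter, Finset.mem_univ, true_and]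
      exact ⟨_, by simpa using hj, by simp, rfl⟩
    · rw [Finset.insert_eq, Finset.union_comm]

lemma exists_mem_U₂ (hp : 1 < E.p) (j k : Fin E.p) : ∃ S ∈ E.U₂, j ∈ S ∧ k ∈ S := by
  have : Nontrivial (Fin E.p) := Fin.nontrivial_iff_two_le.mpr hp
  by_cases hjk : j = k
  · obtain ⟨i, hi⟩ := exists_ne j
    refine ⟨{i, j}, ?_, by simp, by simp [hjk]⟩
    simp [U₂, Finset.card_pair hi]
  · refine ⟨{j, k}, ?_, by simp, by simp⟩
    simp [U₂, Finset.card_pair hjk]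

lemma enorm_dev_fT_le (hs : E.NearlySparse τ) (hn : 0 < n) :
    ‖dev E.X E.fT‖ₑ ≤ E.C₁ * E.Δp₀1 := by
  obtain ⟨S, hS, hSj⟩ := exists_mem_U₃ (E := E) ⟨E.p₀, E.p₀_lt_p⟩
  refine (enorm_dev_le_hkVariation hn E.X_mem (Fin.castLE_injective E.p₀_lt_p.le) (S := S)
    (fun j => hSj (Finset.mem_insert_of_mem (by simp [A₀]))) hs.fTilde_continuous).trans ?_
  exact mul_le_mul' (le_max_left _ _) (Finset.le_sup (f := discrepancyOn E.X) hS)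

lemma enorm_dev_mul_fT_le (hs : E.NearlySparse τ) (hn : 0 < n) (j : Fin E.p) :
    ‖dev E.X (fun x => x j * E.fT x)‖ₑ ≤ E.C₁ * E.Δp₀1 := by
  obtain ⟨S, hS, hSj⟩ := exists_mem_U₃ j
  set R := insert j E.A₀
  -- Only the variables in `R` are kept, so that the variation is the one occurring in `C₁`.
  set g : (R → ℝ) → ℝ := fun z => facePoint R ∅ z j * E.fT (facePoint R ∅ z) with hg
  have hface : ∀ i, Continuous fun z : R → ℝ => facePoint R ∅ z i := by
    intro i
    unfold facePoint
    by_cases hi : i ∈ R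
    · simpa [hi] using continuous_apply (⟨i, hi⟩ : R)
    · simpa [hi] using continuous_const
  have hmem : ∀ z ∈ Icc (0 : R → ℝ) 1, facePoint R ∅ z ∈ Icc (0 : Fin E.p → ℝ) 1 := by
    intro z hz
    have : ∀ i, 0 ≤ facePoint R ∅ z i ∧ facePoint R ∅ z i ≤ 1 := by
      intro i
      unfold facePoint
      split_ifs with h1
      · exact ⟨hz.1 _, hz.2 _⟩
      · simp_all
      · simp
    exact ⟨fun i => (this i).1, fun i => (this i).2⟩
  have hgc : ContinuousOn g (Icc 0 1) :=
    (hface j).continuousOn.mul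
      (hs.continuousOn_fT.comp (continuous_pi hface).continuousOn hmem)
  have hgx : (fun x : Fin E.p → ℝ => g (fun i => x i)) = fun x => x j * E.fT x := by
    funext x
    have h1 : ∀ i ∈ R, facePoint R ∅ (fun i : R => x i) i = x i := by
      intro i hi
      simp [facePoint, hi]
    simp only [hg]
    rw [h1 j (Finset.mem_insert_self _ _),
      E.fT_congr fun i hi => h1 i (Finset.mem_insert_of_mem hi)]
  have h := enorm_dev_le_hkVariation hn E.X_mem (e := fun i : R => (i : Fin E.p))
    Subtype.val_injective (S := S) (fun i => hSj i.2) hgc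
  rw [hgx] at h
  refine h.trans (mul_le_mul' ?_ (Finset.le_sup (f := discrepancyOn E.X) hS))
  exact le_trans (Finset.le_sup (f := fun j => hkVariationOn (insert j E.A₀) fun x =>
    x j * E.fT x) (Finset.mem_univ j)) (le_max_right _ _)

lemma abs_le_toReal_of_enorm_le {x : ℝ} {c : ℝ≥0∞} (hc : c ≠ ⊤) (h : ‖x‖ₑ ≤ c) :
    |x| ≤ c.toReal := by
  rwa [Real.enorm_eq_ofReal_abs, ENNReal.ofReal_le_iff_le_toReal hc] at h

/-- The factor `3/2` comes from `x_j fT - fT / 2`, and `2 η` from replacing `f` by `fT` in both the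
mean and the integral. -/
lemma abs_dev_f_mul_centred_le (hs : E.NearlySparse τ) (hn : 0 < n) (hP : E.C₁ * E.Δp₀1 ≠ ⊤)
    (o : Option (Fin E.p)) :
    |dev E.X (fun x => E.f x * centred o x)| ≤
      3 / 2 * (E.C₁ * E.Δp₀1).toReal + 2 * E.η := by
  have hf := E.f_continuous
  have hfT := hs.continuousOn_fT
  have h1 := abs_le_toReal_of_enorm_le hP (enorm_dev_fT_le hs hn)
  have hP0 : 0 ≤ (E.C₁ * E.Δp₀1).toReal := ENNReal.toReal_nonneg
  have herr : |dev E.X (fun x => (E.f x - E.fT x) * centred o x)| ≤ 2 * E.η := by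
    refine abs_dev_le hn E.X_mem fun x hx => ?_
    rw [abs_mul]
    nlinarith [hs.abs_sub_le hx, abs_centred_le_one o hx, abs_nonneg (E.f x - E.fT x),
      abs_nonneg (centred o x)]
  have hsplit : dev E.X (fun x => E.f x * centred o x) =
      dev E.X (fun x => E.fT x * centred o x) +
        dev E.X (fun x => (E.f x - E.fT x) * centred o x) := by
    rw [← dev_add E.X (integrableOn_cube (by fun_prop)) (integrableOn_cube (by fun_prop))]
    congr 1
    funext x
    ring
  have hmain : |dev E.X (fun x => E.fT x * centred o x)| ≤
      3 / 2 * (E.C₁ * E.Δp₀1).toReal := by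
    cases o with
    | none =>
      simp only [centred, Option.elim, mul_one]
      have : dev E.X (fun x => E.fT x) = dev E.X E.fT := rfl
      rw [this]
      linarith
    | some j =>
      have h2 := abs_le_toReal_of_enorm_le hP (enorm_dev_mul_fT_le hs hn j)
      have h3 : dev E.X (fun x => E.fT x * centred (some j) x) =
          dev E.X (fun x => x j * E.fT x) - 1 / 2 * dev E.X E.fT := by
        rw [← dev_const_mul E.X (1 / 2) E.fT, ← dev_sub E.X (integrableOn_cube (by fun_prop))
          (integrableOn_cube (by fun_prop))]
        congr 1
        funext x
        simp only [centred, Option.elim]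
        ring
      rw [h3]
      refine (abs_sub _ _).trans ?_
      rw [abs_mul, abs_of_pos (by norm_num : (0 : ℝ) < 1 / 2)]
      linarith
  rw [hsplit]
  exact (abs_add_le _ _).trans (add_le_add hmain herr)

lemma abs_dev_centred_mul_le (hn : 0 < n) (hp : 1 < E.p) (hΔ : E.Δ₂ ≠ ⊤)
    (o o' : Option (Fin E.p)) :
    |dev E.X (fun x => centred o x * centred o' x)| ≤ 2 * E.Δ₂.toReal := by
  have h0 : 0 ≤ E.Δ₂.toReal := ENNReal.toReal_nonneg
  have hone : ∀ j : Fin E.p, |dev E.X (fun x => x j - 1 / 2)| ≤ 2 * E.Δ₂.toReal := by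
    intro j
    obtain ⟨S, hS, hj, -⟩ := exists_mem_U₂ hp j j
    have := abs_le_toReal_of_enorm_le hΔ ((enorm_dev_coord_le hn E.X_mem hj).trans
      (Finset.le_sup (f := discrepancyOn E.X) hS))
    linarith
  cases o with
  | none =>
    cases o' with
    | none =>
      simp only [centred, Option.elim, mul_one]
      rw [dev_const E.X hn, abs_zero]
      positivity
    | some k => simpa [centred] using hone k
  | some j =>
    cases o' with
    | none => simpa [centred] using hone j
    | some k =>
      obtain ⟨S, hS, hj, hk⟩ := exists_mem_U₂ hp j k
      have h1 : 2 * E.Δ₂ ≠ ⊤ := ENNReal.mul_ne_top (by simp) hΔ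
      have := abs_le_toReal_of_enorm_le h1 ((enorm_dev_mul_coord_le hn E.X_mem hj hk).trans
        (mul_le_mul_right (Finset.le_sup (f := discrepancyOn E.X) hS) 2))
      rw [ENNReal.toReal_mul, ENNReal.toReal_ofNat] at this
      simpa [centred] using this

/-- The last term collects `m` coefficients of size at most `6 C₂`, each meeting a Gram error of at
most `2 Δ₂`. -/
lemma abs_dev_residual_mul_centred_le (hs : E.NearlySparse τ) (hn : 0 < n) (hp : 1 < E.p)
    (hP : E.C₁ * E.Δp₀1 ≠ ⊤) (hΔ : E.Δ₂ ≠ ⊤) {B : Finset (Option (Fin E.p))} {m : ℕ}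
    (hB : B.card ≤ m) (o : Option (Fin E.p)) :
    |dev E.X (fun x => (E.f x - combo B (projCoeff E.f) x) * centred o x)| ≤
      3 / 2 * (E.C₁ * E.Δp₀1).toReal + 2 * E.η + 12 * m * (E.C₂.toReal * E.Δ₂.toReal) := by
  have hf := E.f_continuous
  have h0 : 0 ≤ E.Δ₂.toReal := ENNReal.toReal_nonneg
  have h1 := abs_dev_f_mul_centred_le hs hn hP o
  have h2 := abs_dev_combo_mul_le (abs_dev_centred_mul_le hn hp hΔ) B (projCoeff E.f) o
  have h3 : ∑ o' ∈ B, |projCoeff E.f o'| ≤ m * (6 * E.C₂.toReal) := by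
    refine (Finset.sum_le_card_nsmul B _ _ fun o' _ => abs_projCoeff_le
      (fun x hx => abs_le_toReal_cubeSup (cubeSup_ne_top E.f_continuous) hx) o').trans ?_
    rw [nsmul_eq_mul]
    have : 0 ≤ E.C₂.toReal := ENNReal.toReal_nonneg
    have hB' : (B.card : ℝ) ≤ m := Nat.cast_le.mpr hB
    exact mul_le_mul_of_nonneg_right hB' (by positivity)
  have h4 := mul_le_mul_of_nonneg_left h3 (by positivity : 0 ≤ 2 * E.Δ₂.toReal)
  simp_rw [sub_mul]
  rw [dev_sub E.X (integrableOn_cube (by fun_prop)) (integrableOn_cube (by fun_prop))]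
  refine (abs_sub _ _).trans ?_
  linarith

/-! ### The signal condition in real numbers -/

/-- An infinite penalty would make the right-hand side `⊥`, so the strict inequality itself yields
finiteness. -/
lemma toReal_lt_of_lt_coe_sub {D x : ℝ} {P : ℝ≥0∞} (h : (D : EReal) < (x : EReal) - (P : EReal)) :
    P ≠ ⊤ ∧ D < x - P.toReal := by
  have hP : P ≠ ⊤ := by
    rintro rfl
    simp at h
  refine ⟨hP, ?_⟩
  rw [← EReal.coe_ennreal_toReal hP, ← EReal.coe_sub] at h
  exact EReal.coe_lt_coe_iff.mp h

lemma ρ₂_le_penalty (α : ℝ) : E.ρ₂ α ≤ E.penalty α := le_add_self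

lemma sq_add_le_ρ₂ (α : ℝ) :
    E.ζ₂ α ^ 2 + 2 * (E.C₄ + ENNReal.ofReal E.η) * E.ζ₂ α ≤ E.ρ₂ α := le_self_add

/-- Factor out `(M + 1)² (9M + 1) ≥ 1` and use `3 ≤ 3 / (1 - α)`. Positivity comes from the `η`
term. -/
lemma ζ₂_bounds {α : ℝ} (hα : α ∈ Ioo (0 : ℝ) 1) (hη : 0 < E.η) (hζ : E.ζ₂ α ≠ ⊤) :
    E.C₁ * E.Δp₀1 ≠ ⊤ ∧ 0 < (E.ζ₂ α).toReal ∧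
      ((E.M : ℝ) + 1) ^ 2 * (9 * E.M + 1) * ((E.C₁ * E.Δp₀1).toReal + 2 * E.η +
        3 * (((E.M : ℝ) + 1) ^ 2 * (9 * E.M + 1)) * (E.C₂.toReal * E.Δ₂.toReal)) ≤
        (E.ζ₂ α).toReal := by
  unfold ζ₂ ζ at hζ ⊢
  obtain ⟨h12, h3⟩ := ENNReal.add_ne_top.mp hζ
  obtain ⟨h1, h2⟩ := ENNReal.add_ne_top.mp h12
  have hK : (1 : ℝ≥0∞) ≤ ((E.M : ℝ≥0∞) + 1) ^ 2 * (9 * E.M + 1) :=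
    one_le_mul (one_le_pow₀ le_add_self) le_add_self
  have hP : E.C₁ * E.Δp₀1 ≠ ⊤ := by
    refine ne_top_of_le_ne_top h1 ?_
    have : E.C₁ * (E.M + 1) ^ 2 * (9 * E.M + 1) * E.Δp₀1 =
        ((E.M : ℝ≥0∞) + 1) ^ 2 * (9 * E.M + 1) * (E.C₁ * E.Δp₀1) := by ring
    rw [this]
    exact le_mul_of_one_le_left' hK
  have hM : ((E.M : ℝ≥0∞) + 1).toReal = (E.M : ℝ) + 1 := by
    rw [ENNReal.toReal_add (by simp) (by simp)]
    simp
  have hM9 : (9 * (E.M : ℝ≥0∞) + 1).toReal = 9 * (E.M : ℝ) + 1 := by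
    rw [ENNReal.toReal_add (ENNReal.mul_ne_top (by simp) (by simp)) (by simp)]
    simp
  have hα3 : (3 : ℝ) ≤ 3 / (1 - α) := by
    rw [le_div_iff₀ (by linarith [hα.2])]
    linarith [hα.1]
  have hQ : 0 ≤ E.C₂.toReal * E.Δ₂.toReal := by positivity
  have hP0 : 0 ≤ E.C₁.toReal * E.Δp₀1.toReal := by positivity
  have hle : ((E.M : ℝ) + 1) ^ 2 * (9 * E.M + 1) * ((E.C₁ * E.Δp₀1).toReal + 2 * E.η +
        3 * (((E.M : ℝ) + 1) ^ 2 * (9 * E.M + 1)) * (E.C₂.toReal * E.Δ₂.toReal)) ≤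
      (E.C₁ * (E.M + 1) ^ 2 * (9 * E.M + 1) * E.Δp₀1
        + 2 * (E.M + 1) ^ 2 * (9 * E.M + 1) * ENNReal.ofReal E.η
        + ENNReal.ofReal (3 / (1 - α)) * E.C₂ * (E.M + 1) ^ 4 * (9 * E.M + 1) ^ 2 *
          E.Δ₂).toReal := by
    rw [ENNReal.toReal_add h12 h3, ENNReal.toReal_add h1 h2]
    simp only [ENNReal.toReal_mul, ENNReal.toReal_pow, hM, hM9, ENNReal.toReal_ofNat,
      ENNReal.toReal_ofReal hη.le, ENNReal.toReal_ofReal ((by norm_num : (0 : ℝ) ≤ 3).trans hα3)]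
    have h4 : 3 * (((E.M : ℝ) + 1) ^ 4 * (9 * E.M + 1) ^ 2 * (E.C₂.toReal * E.Δ₂.toReal)) ≤
        3 / (1 - α) * (((E.M : ℝ) + 1) ^ 4 * (9 * E.M + 1) ^ 2 *
          (E.C₂.toReal * E.Δ₂.toReal)) :=
      mul_le_mul_of_nonneg_right hα3 (by positivity)
    linarith
  refine ⟨hP, lt_of_lt_of_le ?_ hle, hle⟩
  have : 0 ≤ (E.C₁ * E.Δp₀1).toReal := ENNReal.toReal_nonneg
  positivity

lemma signal_bounds {α D : ℝ} (hα : α ∈ Ioo (0 : ℝ) 1) (hD : 0 < D) (hη : 0 < E.η)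
    (hsignal : (D : EReal) < ((12 * τ ^ 2 : ℝ) : EReal) - (E.penalty α : EReal)) :
    E.ζ₂ α ≠ ⊤ ∧ E.C₄ ≠ ⊤ ∧
      (E.ζ₂ α).toReal ^ 2 + 2 * (E.C₄.toReal + E.η) * (E.ζ₂ α).toReal < 12 * τ ^ 2 := by
  obtain ⟨hpen, hlt⟩ := toReal_lt_of_lt_coe_sub hsignal
  have hle : E.ζ₂ α ^ 2 + 2 * (E.C₄ + ENNReal.ofReal E.η) * E.ζ₂ α ≤ E.penalty α :=
    (sq_add_le_ρ₂ α).trans (ρ₂_le_penalty α)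
  have hfin := ne_top_of_le_ne_top hpen hle
  obtain ⟨h1, h2⟩ := ENNReal.add_ne_top.mp hfin
  have hζ : E.ζ₂ α ≠ ⊤ := by
    intro h
    rw [h] at h1
    simp at h1
  -- Needed because `⊤ * 0 = 0`: finiteness of the product bounds `C₄` only if `ζ₂` is nonzero.
  have hζ0 : E.ζ₂ α ≠ 0 := by
    intro h
    have := (ζ₂_bounds hα hη hζ).2.1
    rw [h] at this
    simp at this
  have hC : E.C₄ ≠ ⊤ := by
    intro h
    rw [h] at h2
    simp [ENNReal.top_mul hζ0] at h2
  refine ⟨hζ, hC, ?_⟩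
  have h3 := ENNReal.toReal_mono hpen hle
  rw [ENNReal.toReal_add h1 h2, ENNReal.toReal_mul, ENNReal.toReal_mul,
    ENNReal.toReal_add hC ENNReal.ofReal_ne_top, ENNReal.toReal_pow, ENNReal.toReal_ofNat,
    ENNReal.toReal_ofReal hη.le] at h3
  linarith

lemma Δ₂_bounds {α : ℝ} (hα : α ∈ Ioo (0 : ℝ) 1)
    (hdisc : 3 * ((E.M : ℝ≥0∞) + 1) ^ 2 * (9 * (E.M : ℝ≥0∞) + 1) * E.Δ₂ < ENNReal.ofReal α) :
    E.Δ₂ ≠ ⊤ ∧ 3 * ((E.M : ℝ) + 1) ^ 2 * (9 * E.M + 1) * E.Δ₂.toReal ≤ 1 := by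
  have hM : ((E.M : ℝ≥0∞) + 1).toReal = (E.M : ℝ) + 1 := by
    rw [ENNReal.toReal_add (by simp) (by simp)]
    simp
  have hM9 : (9 * (E.M : ℝ≥0∞) + 1).toReal = 9 * (E.M : ℝ) + 1 := by
    rw [ENNReal.toReal_add (ENNReal.mul_ne_top (by simp) (by simp)) (by simp)]
    simp
  constructor
  · intro h
    rw [h, ENNReal.mul_top (by simp)] at hdisc
    exact not_top_lt hdisc
  · have := ENNReal.toReal_lt_of_lt_ofReal hdisc
    simp only [ENNReal.toReal_mul, ENNReal.toReal_pow, hM, hM9, ENNReal.toReal_ofNat] at this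
    linarith [hα.2]

/-- All the error terms together stay below `ζ² + 2 (c + η) ζ`. -/
lemma error_terms_le {m P η Q c ζ : ℝ} (hm : 1 ≤ m) (hP : 0 ≤ P) (hη : 0 ≤ η) (hQ : 0 ≤ Q)
    (hc : 0 ≤ c)
    (hζ : (m + 1) ^ 2 * (9 * m + 1) * (P + 2 * η + 3 * ((m + 1) ^ 2 * (9 * m + 1)) * Q) ≤ ζ) :
    m * (12 * (3 / 2 * P + 2 * η + 12 * (m + 1) * Q) * (c + η)) +
      m * (3 * η ^ 2 + 12 * (3 / 2 * P + 2 * η + 12 * (m + 1) * Q) * η) +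
      9 / 7 * (3 / 2 * P + 2 * η + 12 * (m + 1) * Q) ^ 2 * (1 + 12 * m) ≤
    ζ ^ 2 + 2 * (c + η) * ζ := by
  set K := (m + 1) ^ 2 * (9 * m + 1) with hK
  set ε := 3 / 2 * P + 2 * η + 12 * (m + 1) * Q with hε
  -- This slack makes `m ε` and `m η` small multiples of `ζ`: `3/80` is `3/2` over 40, and `1/80` is
  -- `1/2` over 40.
  have hK40 : 40 * m ≤ K := by
    have h1 : 4 * m ≤ (m + 1) ^ 2 := by nlinarith [sq_nonneg (m - 1)]
    have h2 := mul_le_mul h1 (by linarith : (10 : ℝ) ≤ 9 * m + 1) (by norm_num) (sq_nonneg _)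
    linarith
  have hε0 : 0 ≤ ε := by positivity
  have hS : 0 ≤ P + 2 * η + 3 * K * Q := by positivity
  have hKQ : 40 * m * Q ≤ K * Q := mul_le_mul_of_nonneg_right hK40 hQ
  have hmQ : Q ≤ m * Q := le_mul_of_one_le_left hQ hm
  have hε1 : ε ≤ 3 / 2 * (P + 2 * η + 3 * K * Q) := by
    simp only [hε]
    nlinarith
  have hmS : 40 * m * (P + 2 * η + 3 * K * Q) ≤ ζ :=
    (mul_le_mul_of_nonneg_right hK40 hS).trans hζ
  have hmε : m * ε ≤ 3 / 80 * ζ := by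
    have := mul_le_mul_of_nonneg_left hε1 (by linarith : 0 ≤ m)
    linarith
  have hmη : m * η ≤ 1 / 80 * ζ := by
    have h1 : 2 * η ≤ P + 2 * η + 3 * K * Q := by
      have : 0 ≤ 3 * K * Q := by positivity
      linarith
    have := mul_le_mul_of_nonneg_left h1 (by linarith : 0 ≤ 40 * m)
    linarith
  have hζ0 : 0 ≤ ζ := le_trans (by positivity) hmS
  have hηζ : η ≤ 1 / 80 * ζ := (le_mul_of_one_le_left hη hm).trans hmη
  have t1 : m * ε * (c + η) ≤ 3 / 80 * ζ * (c + η) :=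
    mul_le_mul_of_nonneg_right hmε (by positivity)
  have t2 : m * η * η ≤ 1 / 80 * ζ * (1 / 80 * ζ) := mul_le_mul hmη hηζ hη (by positivity)
  have t3 : m * ε * η ≤ 3 / 80 * ζ * η := mul_le_mul_of_nonneg_right hmε hη
  have t4 : ε ^ 2 * (1 + 12 * m) ≤ 13 * (3 / 80 * ζ) ^ 2 := by
    have h1 : ε ^ 2 * (1 + 12 * m) ≤ 13 * (m * ε) ^ 2 := by
      have : 1 + 12 * m ≤ 13 * m ^ 2 := by nlinarith
      nlinarith [mul_le_mul_of_nonneg_left this (sq_nonneg ε)]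
    have h2 := pow_le_pow_left₀ (by positivity) hmε 2
    linarith
  have t5 : 0 ≤ ζ * c := by positivity
  have t6 : 0 ≤ ζ * η := by positivity
  nlinarith

lemma sum_inv_centredNormSq {p : ℕ} (A : Finset (Fin p)) :
    ∑ o ∈ Finset.insertNone A, (centredNormSq o)⁻¹ = 1 + 12 * A.card := by
  rw [Finset.sum_insertNone]
  simp [centredNormSq, mul_comm]

/-- The difference of the mean squared errors of the projections on the variables in `A₀` and
in `A₁`. -/
lemma le_mean_sq_sub_of_missing (hs : E.NearlySparse τ) {A₁ : Finset (Fin E.p)} {m : ℕ}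
    (hτ : 0 < τ) (hm₀ : E.A₀.card ≤ m) (hm₁ : A₁.card ≤ m) (hne : (E.A₀ \ A₁).Nonempty) {c ε : ℝ}
    (hc : ∀ x ∈ Icc (0 : Fin E.p → ℝ) 1, |E.blaResidual A₁ x| ≤ c)
    (hε : ∀ A : Finset (Fin E.p), A.card ≤ m → ∀ o, |dev E.X (fun x =>
      (E.f x - combo (Finset.insertNone A) (projCoeff E.f) x) * centred o x)| ≤ ε) :
    12 * τ ^ 2 - m * (12 * ε * (c + E.η)) - m * (3 * E.η ^ 2 + 12 * ε * E.η) ≤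
      (∑ i, (E.f (E.X i) - combo (Finset.insertNone A₁) (projCoeff E.f) (E.X i)) ^ 2) / n -
      (∑ i, (E.f (E.X i) - combo (Finset.insertNone E.A₀) (projCoeff E.f) (E.X i)) ^ 2) / n := by
  have hη := hs.η_pos
  have hε0 : 0 ≤ ε := (abs_nonneg _).trans (hε _ hm₀ none)
  have hc0 : 0 ≤ c := (abs_nonneg _).trans (hc 0 ⟨le_rfl, zero_le_one⟩)
  refine le_trans ?_ (le_mean_sq_sub_proj_sub E.f_continuous (hε _ hm₀) (hε _ hm₁))
  have hsdiff : ∀ A B : Finset (Fin E.p), Finset.insertNone A \ Finset.insertNone B =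
      (A \ B).map Function.Embedding.some := by
    intro A B
    ext o
    cases o <;> simp
  have hproj : ∀ j : Fin E.p, |projCoeff E.f (some j)| = 12 * |innerCentred E.f (some j)| := by
    intro j
    unfold projCoeff
    rw [abs_div]
    simp only [centredNormSq, Option.elim]
    rw [abs_of_pos (by norm_num : (0 : ℝ) < 1 / 12)]
    ring
  rw [hsdiff, hsdiff, Finset.sum_map, Finset.sum_map]
  simp only [Function.Embedding.some_apply, hproj]
  simp only [centredNormSq, Option.elim]
  have h1 : 12 * τ ^ 2 - m * (12 * ε * (c + E.η)) ≤ ∑ j ∈ E.A₀ \ A₁,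
      (innerCentred E.f (some j) ^ 2 / (1 / 12) -
        2 * ε * (12 * |innerCentred E.f (some j)|)) := by
    have hterm : ∀ j ∈ E.A₀ \ A₁, 12 * τ ^ 2 - 12 * ε * (c + E.η) ≤
        innerCentred E.f (some j) ^ 2 / (1 / 12) -
          2 * ε * (12 * |innerCentred E.f (some j)|) := by
      intro j hj
      rw [Finset.mem_sdiff] at hj
      have h2 := lt_abs_innerCentred hs hj.1
      have h3 := abs_innerCentred_le_blaResidual hs hj.2 hc
      have h4 : τ ^ 2 ≤ innerCentred E.f (some j) ^ 2 := by
        rw [← sq_abs (innerCentred E.f (some j))]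
        exact pow_le_pow_left₀ hτ.le h2.le 2
      have h5 := mul_le_mul_of_nonneg_left h3 hε0
      linarith
    -- The gain is counted for at least one missed active input, the error for at most `m` of them.
    refine le_trans ?_ (Finset.card_nsmul_le_sum _ _ _ hterm)
    have hk1 : (1 : ℝ) ≤ (E.A₀ \ A₁).card := by
      exact_mod_cast Finset.card_pos.mpr hne
    have hk2 : ((E.A₀ \ A₁).card : ℝ) ≤ m := by
      exact_mod_cast (Finset.card_le_card Finset.sdiff_subset).trans hm₀
    rw [nsmul_eq_mul, mul_sub]
    have h6 : 12 * τ ^ 2 ≤ (E.A₀ \ A₁).card * (12 * τ ^ 2) :=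
      le_mul_of_one_le_left (by positivity) hk1
    have h7 : (E.A₀ \ A₁).card * (12 * ε * (c + E.η)) ≤ m * (12 * ε * (c + E.η)) :=
      mul_le_mul_of_nonneg_right hk2 (by positivity)
    linarith
  have h2 : ∑ j ∈ A₁ \ E.A₀, (innerCentred E.f (some j) ^ 2 / (1 / 12) +
      2 * ε * (12 * |innerCentred E.f (some j)|)) ≤ m * (3 * E.η ^ 2 + 12 * ε * E.η) := by
    have hterm : ∀ j ∈ A₁ \ E.A₀, innerCentred E.f (some j) ^ 2 / (1 / 12) +
        2 * ε * (12 * |innerCentred E.f (some j)|) ≤ 3 * E.η ^ 2 + 12 * ε * E.η := by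
      intro j hj
      rw [Finset.mem_sdiff] at hj
      have h3 := abs_innerCentred_le_of_notMem hs hj.2
      have h4 : innerCentred E.f (some j) ^ 2 ≤ (E.η / 2) ^ 2 := by
        rw [← sq_abs (innerCentred E.f (some j))]
        exact pow_le_pow_left₀ (abs_nonneg _) h3 2
      have h5 := mul_le_mul_of_nonneg_left h3 hε0
      linarith
    refine (Finset.sum_le_card_nsmul _ _ _ hterm).trans ?_
    have hk2 : ((A₁ \ E.A₀).card : ℝ) ≤ m := by
      exact_mod_cast (Finset.card_le_card Finset.sdiff_subset).trans hm₁
    rw [nsmul_eq_mul]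
    exact mul_le_mul_of_nonneg_right hk2 (by positivity)
  linarith

/-- The screening theorem for a single experiment. -/
theorem rss_lt_rss {α D : ℝ} (hn : 0 < n) (hτ : 0 < τ) (hα : α ∈ Ioo (0 : ℝ) 1) (hD : 0 < D)
    (hs : E.NearlySparse τ)
    (hdisc : 3 * ((E.M : ℝ≥0∞) + 1) ^ 2 * (9 * (E.M : ℝ≥0∞) + 1) * E.Δ₂ < ENNReal.ofReal α)
    (hsignal : (D : EReal) < ((12 * τ ^ 2 : ℝ) : EReal) - (E.penalty α : EReal))
    {A A₁ : Finset (Fin E.p)} (hA : A ∈ E.U₀) (hA₁ : A₁ ∈ E.U₁) :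
    rss E.X E.y A < rss E.X E.y A₁ := by
  have hη := hs.η_pos
  obtain ⟨hζ, hC₄, hlt⟩ := signal_bounds hα hD hη hsignal
  obtain ⟨hP, -, hζle⟩ := ζ₂_bounds hα hη hζ
  obtain ⟨hΔ, hΔle⟩ := Δ₂_bounds hα hdisc
  simp only [U₀, Finset.mem_filter, Finset.mem_univ, true_and] at hA
  have hA₁' := hA₁
  simp only [U₁, Finset.mem_filter, Finset.mem_univ, true_and] at hA₁'
  obtain ⟨hcard, hsub⟩ := hA
  obtain ⟨hcard₁, hne⟩ := hA₁'
  have hp₀ : 0 < E.p₀ := by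
    obtain ⟨j, hj⟩ := hne
    have := (Finset.mem_sdiff.mp hj).1
    simp only [A₀, Finset.mem_filter, Finset.mem_univ, true_and] at this
    omega
  have hp : 1 < E.p := by
    have := E.p₀_lt_p
    omega
  have hM1 : (1 : ℝ) ≤ E.M := by
    have := E.p₀_le_M
    exact_mod_cast (by omega : 1 ≤ E.M)
  have hn' : (0 : ℝ) < n := Nat.cast_pos.mpr hn
  have hd0 : 0 ≤ E.Δ₂.toReal := ENNReal.toReal_nonneg
  have hd := abs_dev_centred_mul_le hn hp hΔ
  -- The inverse weights add up to `1 + 12 M`, and `9 (1 + 12 M) ≤ 3 (M + 1)² (9M + 1)`, so the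
  -- discrepancy bound gives 2/9.
  have hgram : ∀ B : Finset (Fin E.p), B.card = E.M →
      2 * E.Δ₂.toReal * ∑ o ∈ Finset.insertNone B, (centredNormSq o)⁻¹ ≤ 2 / 9 := by
    intro B hB
    rw [sum_inv_centredNormSq, hB]
    have h1 : 9 * (1 + 12 * (E.M : ℝ)) ≤ 3 * ((E.M : ℝ) + 1) ^ 2 * (9 * E.M + 1) := by
      nlinarith [sq_nonneg ((E.M : ℝ) - 1), mul_nonneg (sub_nonneg.mpr hM1) (sq_nonneg (E.M : ℝ))]
    have h2 := mul_le_mul_of_nonneg_right h1 hd0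
    linarith
  set ε := 3 / 2 * (E.C₁ * E.Δp₀1).toReal + 2 * E.η +
    12 * ((E.M : ℝ) + 1) * (E.C₂.toReal * E.Δ₂.toReal) with hεdef
  have hε : ∀ B : Finset (Fin E.p), B.card ≤ E.M → ∀ o, |dev E.X (fun x =>
      (E.f x - combo (Finset.insertNone B) (projCoeff E.f) x) * centred o x)| ≤ ε := by
    intro B hB o
    have := abs_dev_residual_mul_centred_le hs hn hp hP hΔ (B := Finset.insertNone B)
      -- The extra 1 counts the intercept.
      (m := E.M + 1) (by rw [Finset.card_insertNone]; omega) o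
    push_cast at this
    exact this
  have hc : ∀ x ∈ Icc (0 : Fin E.p → ℝ) 1, |E.blaResidual A₁ x| ≤ E.C₄.toReal := by
    have hle : cubeSup (E.blaResidual A₁) ≤ E.C₄ :=
      Finset.le_sup (f := fun A => cubeSup (E.blaResidual A)) hA₁
    intro x hx
    exact (abs_le_toReal_cubeSup (ne_top_of_le_ne_top hC₄ hle) hx).trans
      (ENNReal.toReal_mono hC₄ hle)
  have hcard₀ : E.A₀.card ≤ E.M := hcard ▸ Finset.card_le_card hsub
  have hmain := le_mean_sq_sub_of_missing hs hτ hcard₀ hcard₁.le hne hc hε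
  have herr := error_terms_le hM1 ENNReal.toReal_nonneg hη.le
    (by positivity : 0 ≤ E.C₂.toReal * E.Δ₂.toReal)
    (ENNReal.toReal_nonneg : 0 ≤ E.C₄.toReal) hζle
  rw [← hεdef] at herr
  have hupper : rss E.X E.y A ≤
      ∑ i, (E.f (E.X i) - combo (Finset.insertNone E.A₀) (projCoeff E.f) (E.X i)) ^ 2 := by
    have h1 := rss_le_sum_sq (isUnit_det_gram (le_mean_combo_sq hd0 hd (hgram A hcard))) E.y
      (b := ofCentred E.A₀ (projCoeff E.f)) (fun j hj => if_neg fun h => hj (hsub h))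
    simp_rw [affine_ofCentred] at h1
    exact h1
  -- The lower bound holds for arbitrary coefficients, in particular for the fitted ones; optimality
  -- matters only for `A`.
  have hlower := mean_sq_sub_proj_le E.f_continuous hd0 hd (hgram A₁ hcard₁) (hε A₁ hcard₁.le)
    (toCentred (lsCoeff E.X E.y A₁))
  simp_rw [← affine_eq_combo (lsCoeff_eq_zero (X := E.X) (y := E.y) (A := A₁))] at hlower
  rw [sum_inv_centredNormSq, hcard₁] at hlower
  have hrss : (∑ i, (E.f (E.X i) - affine (lsCoeff E.X E.y A₁) (E.X i)) ^ 2) / (n : ℝ) =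
      rss E.X E.y A₁ / n := rfl
  rw [hrss] at hlower
  have hupper' := div_le_div_of_nonneg_right hupper hn'.le
  rw [← div_lt_div_iff_of_pos_right hn']
  linarith

end Experiment

end LinearScreening

theorem theorem2 (E : (n : ℕ) → LinearScreening.Experiment n) (τ α D : ℝ)
    (hτ : 0 < τ) (hα : α ∈ Set.Ioo (0 : ℝ) 1) (hD : 0 < D)
    (hsparse : ∀ n, (E n).NearlySparse τ)
    (hBVHK : ∀ n, LinearScreening.hkVariation (E n).fTilde < ⊤)
    (hdisc : ∀ᶠ n in Filter.atTop,
      3 * (((E n).M : ENNReal) + 1) ^ 2 * (9 * ((E n).M : ENNReal) + 1) * (E n).Δ₂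
        < ENNReal.ofReal α)
    (hsignal : ∀ᶠ n in Filter.atTop,
      (D : EReal) < ((12 * τ ^ 2 : ℝ) : EReal) - ((E n).penalty α : EReal)) :
    ∀ᶠ n in Filter.atTop, ∀ A ∈ (E n).U₀, ∀ A₁ ∈ (E n).U₁,
      LinearScreening.rss (E n).X (E n).y A < LinearScreening.rss (E n).X (E n).y A₁ := by
  filter_upwards [hdisc, hsignal, Filter.eventually_gt_atTop 0] with n hd hs hn A hA A₁ hA₁
  exact LinearScreening.Experiment.rss_lt_rss hn hτ hα hD (hsparse n) hd hs hA hA₁
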